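/- Let $\{X_n\}_{n\in\mathbb Z}$ be a stationary ergodic process on a probability space with values in a finite or countably infinite alphabet $\mathcal X$. Write $X_m^n=(X_m,\dots,X_n)$ (the empty word if $m>n$), and, for words written $w=w_{-k+1}^0$ of length $|w|=k\ge 0$, $p(w)=P(X_{-k+1}^0=w)$ and $p(y\mid w)=P(X_1=y\mid X_{-k+1}^0=w)$. Say that the past before $w$ is irrelevant if $p(y\mid w)=p(y\mid zw)$ for all nonempty words $z$ and all letters $y$ with $p(zwy)>0$. The memory length $K(X_{-\infty}^n)$ is the smallest $K\ge 0$ such that the past before the word $X_{n-K+1}^n$ is irrelevant ($\infty$ if there is none). Assume that the process is finitarily Markovian, i.e. $K(X_{-\infty}^0)<\infty$ almost surely. Fix $0<\gamma<1$ and $0<\beta<\frac{1-\gamma}{2}$. For a sequence $x\in\mathcal X^{\mathbb Z}$, a word $w$ of length $k$, and a letter $a$, put $$\hat p_n(a\mid w)=\frac{\#\{-n+k-1\le t\le -1: x_{t-k+1}^{t+1}=wa\}}{\#\{-n+k-1\le t\le -1: x_{t-k+1}^{t}=w\}},$$ call a word $u$ frequent if it appears more than $n^{1-\gamma}$ times in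 $x_{-n}^0$, and let $\hat\Delta^n(w)$ be the maximum of $|\hat p_n(a\mid w)-\hat p_n(a\mid zw)|$ over all words $z$ with $1\le |z|\le n$ and letters $a$ such that $zwa$ is frequent (and $0$ if there are no such $z,a$). Let $NTEST_n(w)(x)=YES$ if and only if $\hat\Delta^n(w)\le n^{-\beta}$, and $PTEST_n(w)(x)=NTEST_n(w)(T^nx)$, where $(T^nx)_t=x_{t+n}$; thus $PTEST_n(w)$ depends only on $x_0^n$. Let $w(0),w(1),\dots$ be an enumeration of all words of all lengths over $\mathcal X$ (so $w(0)$ is the empty word) in which no word precedes one of its suffixes. Fix $\epsilon>0$. Let $A_n^i=\{j: 0\le j\le n,\ j\ge |w(i)|-1,\ X_{j-|w(i)|+1}^j=w(i)\}$, let $\theta_n$ be the least $j<n$ such that $$\frac{1}{n+1}\Bigl|\bigcup_{i\le j,\ PTEST_n(w(i))=YES}A_n^i\Bigr|\ge 1-\frac{\epsilon}{2},$$ and $\theta_n=n$ if there is no such $j$. Let $\mathcal N$ be the random set of all $n\ge 0$ with $n\in\bigcup_{i\le\theta_n,\ PTEST_n(w(i))=YES}A_n^i$, and let $\rho_n=|w(\kappa_n)|$,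 where, for $n\in\mathcal N$, $$\kappa_n=\min\{i\ge 0: |w(i)|\le n+1,\ X_{n-|w(i)|+1}^n=w(i),\ PTEST_n(w(i))=YES\}$$ (where the set is empty, which can only happen if $n\notin\mathcal N$, put $\kappa_n=0$). Then: 1. for every $n$, the event $\{n\in\mathcal N\}$ and the random variable $\rho_n$ are measurable with respect to $\sigma(X_0,\dots,X_n)$; 2. almost surely, for all sufficiently large $n\in\mathcal N$, $\rho_n=K(X_{-\infty}^n)$; 3. almost surely, $\displaystyle\liminf_{n\to\infty}\frac{|\mathcal N\cap\{0,1,\dots,n-1\}|}{n}\ge 1-\epsilon$; 4. almost surely, for all sufficiently large $n\in\mathcal N$, the word $X_{n-\rho_n+1}^n$ appears at least $n^{1-\gamma}$ times in $X_0^n$ (the empty word being counted $n+1$ times). -/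

import Mathlib

open MeasureTheory Filter

noncomputable section

namespace MemoryEstimation

variable {A Ω : Type*}

/-! ### Blocks, stationarity, memory -/

/-- The block `x_{m-k+1}^m = (x_{m-k+1}, …, x_m)`, a word of length `k` (empty when `k = 0`). -/
def block (x : ℤ → A) (m : ℤ) (k : ℕ) : List A :=
  List.ofFn fun i : Fin k => x (m - k + 1 + (i : ℕ))

/-- The sample path `n ↦ X_n(ω)` of a two-sided time series. -/
def path (X : ℤ → Ω → A) (ω : Ω) : ℤ → A := fun n => X n ω

/-- The `n`-th power of the left shift, `(T^n x)_t = x_{t+n}`. -/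
def shift (n : ℤ) (x : ℤ → A) : ℤ → A := fun t => x (t + n)

/-- The time series is stationary and ergodic: the law of its sample path is invariant
(this is part of Mathlib's `Ergodic`) and ergodic under the left shift. -/
def IsStationaryErgodic [MeasurableSpace A] [MeasurableSpace Ω]
    (μ : Measure Ω) (X : ℤ → Ω → A) : Prop :=
  Ergodic (shift (A := A) 1) (μ.map (path X))

/-- The event `X_{-k+1}^0 = w`, where `k` is the length of `w`. -/
def wordEvent (X : ℤ → Ω → A) (w : List A) : Set Ω :=
  {ω | block (path X ω) 0 w.length = w}

/-- `p(w) = P(X_{-k+1}^0 = w)`. -/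
def wordProb [MeasurableSpace Ω] (μ : Measure Ω) (X : ℤ → Ω → A) (w : List A) : ℝ :=
  μ.real (wordEvent X w)

/-- `p(y | w) = P(X_1 = y | X_{-k+1}^0 = w)`. -/
def nextProb [MeasurableSpace Ω] (μ : Measure Ω) (X : ℤ → Ω → A) (y : A) (w : List A) : ℝ :=
  (ProbabilityTheory.cond μ (wordEvent X w)).real {ω | X 1 ω = y}

/-- `p(y | w) = p(y | z w)` for all nonempty words `z` and letters `y` with `p(z w y) > 0`. -/
def PastIrrelevant [MeasurableSpace Ω] (μ : Measure Ω) (X : ℤ → Ω → A) (w : List A) : Prop :=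
  ∀ (z : List A) (y : A), 1 ≤ z.length → 0 < wordProb μ X (z ++ w ++ [y]) →
    nextProb μ X y w = nextProb μ X y (z ++ w)

/-- The memory length `K(x_{-∞}^n)`: the least `K` such that the block `x_{n-K+1}^n` makes the
earlier past irrelevant, and `⊤` if there is no such `K`. -/
def memoryLength [MeasurableSpace Ω] (μ : Measure Ω) (X : ℤ → Ω → A) (x : ℤ → A) (n : ℤ) : ℕ∞ :=
  sInf ((fun k : ℕ => (k : ℕ∞)) '' {k : ℕ | PastIrrelevant μ X (block x n k)})

/-- The time series is finitarily Markovian: `K(X_{-∞}^0)` is finite almost surely. -/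
def IsFinitarilyMarkovian [MeasurableSpace Ω] (μ : Measure Ω) (X : ℤ → Ω → A) : Prop :=
  ∀ᵐ ω ∂μ, memoryLength μ X (path X ω) 0 ≠ ⊤

/-! ### The test for memory words -/

open scoped Classical in
/-- The empirical conditional probability of the letter `a` given the word `w` (of length `k`),
computed from `x_{-n}^0`: the number of `-n+k-1 ≤ t ≤ -1` with `x_{t-k+1}^{t+1} = w a`, divided by
the number of those with `x_{t-k+1}^t = w`. -/
def empProb (n : ℕ) (x : ℤ → A) (a : A) (w : List A) : ℝ :=
  (((Finset.Icc (-(n : ℤ) + w.length - 1) (-1)).filter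
      fun t => block x (t + 1) (w.length + 1) = w ++ [a]).card : ℝ) /
    (((Finset.Icc (-(n : ℤ) + w.length - 1) (-1)).filter
      fun t => block x t w.length = w).card : ℝ)

open scoped Classical in
/-- The word `u` appears more than `n^{1-γ}` times in `x_{-n}^0`. -/
def IsFrequent (γ : ℝ) (n : ℕ) (x : ℤ → A) (u : List A) : Prop :=
  (n : ℝ) ^ (1 - γ) <
    (((Finset.Icc (-(n : ℤ) + u.length - 1) 0).filter
      fun t => block x t u.length = u).card : ℝ)

/-- The empirical deviation of `w` from being a memory word: the maximum of
`|p̂(a | w) - p̂(a | z w)|` over words `z` with `1 ≤ |z| ≤ n` and letters `a` such that `z w a`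
is frequent in `x_{-n}^0`. Only finitely many `(z, a)` qualify, so the supremum is a maximum,
and it is `0` if there are none. -/
def empDelta (γ : ℝ) (n : ℕ) (x : ℤ → A) (w : List A) : ℝ :=
  sSup {r : ℝ | ∃ (z : List A) (a : A), 1 ≤ z.length ∧ z.length ≤ n ∧
    IsFrequent γ n x (z ++ w ++ [a]) ∧ r = |empProb n x a w - empProb n x a (z ++ w)|}

/-- The backward test, based on `x_{-n}^0`, answers YES for `w`. -/
def NTest (γ β : ℝ) (n : ℕ) (x : ℤ → A) (w : List A) : Prop :=
  empDelta γ n x w ≤ (n : ℝ) ^ (-β)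

/-- The forward test, based on `x_0^n`, answers YES for `w`: the backward test applied to
`T^n x`. -/
def PTest (γ β : ℝ) (n : ℕ) (x : ℤ → A) (w : List A) : Prop :=
  NTest γ β n (shift n x) w

/-! ### The forward estimator -/

/-- An enumeration `w(0), w(1), …` of all words over `A` (the empty word included) in which no
word precedes one of its suffixes. -/
structure IsWordList (w : ℕ → List A) : Prop where
  bijective : Function.Bijective w
  suffix_le : ∀ i j : ℕ, w i <:+ w j → i ≤ j

open scoped Classical in
/-- The set of `j` with `|u| - 1 ≤ j ≤ n`, `j ≥ 0` and `x_{j-|u|+1}^j = u`: the end positions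
of the occurrences of `u` in `x_0^n`. For the empty word this is `{0, …, n}`. -/
def occurrences (n : ℕ) (x : ℤ → A) (u : List A) : Finset ℕ :=
  (Finset.range (n + 1)).filter fun j => u.length ≤ j + 1 ∧ block x j u.length = u

open scoped Classical in
/-- The union of the sets `A_n^i = occurrences of w(i)` over the `i ≤ j` for which the forward
test answers YES for `w(i)`. -/
def covered (γ β : ℝ) (w : ℕ → List A) (n : ℕ) (x : ℤ → A) (j : ℕ) : Finset ℕ :=
  ((Finset.range (j + 1)).filter fun i => PTest γ β n x (w i)).biUnion
    fun i => occurrences n x (w i)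

/-- `θ_n(ε)`: the least `j < n` such that the covered set has relative size at least `1 - ε/2`
in `{0, …, n}`, and `n` if there is no such `j`. -/
def theta (γ β ε : ℝ) (w : ℕ → List A) (n : ℕ) (x : ℤ → A) : ℕ :=
  sInf {j : ℕ | (j < n ∧
    1 - ε / 2 ≤ ((covered γ β w n x j).card : ℝ) / ((n : ℝ) + 1)) ∨ j = n}

/-- The set `𝒩` of times at which the memory is estimated. -/
def estTimes (γ β ε : ℝ) (w : ℕ → List A) (x : ℤ → A) : Set ℕ :=
  {n | n ∈ covered γ β w n x (theta γ β ε w n x)}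

/-- `κ_n`: the least `i` such that `w(i)` is a suffix of `x_0^n` for which the forward test
answers YES (such an `i` exists whenever `n ∈ 𝒩`). -/
def kappa (γ β : ℝ) (w : ℕ → List A) (n : ℕ) (x : ℤ → A) : ℕ :=
  sInf {i : ℕ | (w i).length ≤ n + 1 ∧ block x n (w i).length = w i ∧ PTest γ β n x (w i)}

/-- The estimator `ρ_n = |w(κ_n)|`. -/
def rho (γ β : ℝ) (w : ℕ → List A) (n : ℕ) (x : ℤ → A) : ℕ :=
  (w (kappa γ β w n x)).length

open scoped Classical in
/-- The proportion `|S ∩ {0, …, n-1}| / n`. -/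
def proportion (S : Set ℕ) (n : ℕ) : ℝ :=
  (((Finset.range n).filter fun m => m ∈ S).card : ℝ) / (n : ℝ)

/-- The σ-algebra generated by `X_0, …, X_n`. -/
abbrev observed [MeasurableSpace A] (X : ℤ → Ω → A) (n : ℕ) : MeasurableSpace Ω :=
  MeasurableSpace.comap (fun ω (i : Fin (n + 1)) => X ((i : ℕ) : ℤ) ω) inferInstance

end MemoryEstimation

end

noncomputable section

namespace MemoryEstimation

open scoped Topology ENNReal

/-! The core is that the test eventually classifies correctly every word that occurs on the path
(`ae_eventually_ptest_iff`). If `w` is not a memory word, some `z` and `a` with p(zwa) > 0 witness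
it. By Birkhoff's theorem the two empirical probabilities converge to different limits, while the
threshold n^{-β} tends to 0 and the count of `zwa` grows linearly and so exceeds n^{1-γ}; hence the
answer is NO (`ae_eventually_not_ptest`).

If `w` is a memory word, after any word ending in `w` the next letter has the fixed law q(·) = p(· |
w) (`IsMemoryWord.lawProb_append`). Deviations of letter counts from q along predictable times then
form a martingale, and an exponential supermartingale gives a bound that is uniform in the random
number of visits (`measure_deviation_le`). There may be infinitely many candidate words `zw`, so a
word is named by a place (i, l) on the path where it stands; only (n+1)² places matter. Letters need
the same care: overrepresentation is tested for the letter read at time i, underrepresentation for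
each letter a at a cost proportional to q(a), which is summable. With at least about n^{1-γ} visits
and deviation of order n^{-β}, the exponent is of order n^{1-γ-2β}, so Borel–Cantelli applies
(`IsMemoryWord.ae_eventually_ptest`).

For the estimator, let P(j) be the probability that a memory word among w(0), …, w(j) ends at time
0. The finitary Markov property gives P(j) → 1. With j₀ the first index where P(j₀) ≥ 1-ε/2 and J
any index where P(J) > 1-ε/2, eventually j₀ ≤ θ_n ≤ J (`eventually_theta_mem_Icc`). Hence only
finitely many words matter from some time on, all of them correctly classified where they occur.
Since suffixes come first in the list, the first accepted word is the shortest memory suffix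
(`kappa_spec`); it has positive probability, so it occurs often; and the estimation times have lower
density at least P(j₀) ≥ 1-ε/2 > 1-ε (`le_liminf_proportion`, `ae_estimator`). -/

/-! ### The pointwise ergodic theorem for bounded functions -/

section Birkhoff

variable {S : Type*} {T : S → S}

/-- The running maximum of the Birkhoff sums of `g` up to time `n`. -/
def runningMax (T : S → S) (g : S → ℝ) : ℕ → S → ℝ
  | 0 => fun _ => 0
  | n + 1 => fun x => max 0 (g x + runningMax T g n (T x))

lemma runningMax_nonneg (g : S → ℝ) (n : ℕ) (x : S) : 0 ≤ runningMax T g n x := by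
  cases n with
  | zero => exact le_rfl
  | succ n => exact le_max_left _ _

lemma runningMax_le_succ (g : S → ℝ) (n : ℕ) (x : S) :
    runningMax T g n x ≤ runningMax T g (n + 1) x := by
  induction n generalizing x with
  | zero => exact le_max_left _ _
  | succ n ih =>
    have := ih (T x)
    exact max_le_max le_rfl (by linarith)

lemma birkhoffSum_le_runningMax (g : S → ℝ) (n : ℕ) (x : S) :
    birkhoffSum T g n x ≤ runningMax T g n x := by
  induction n generalizing x with
  | zero => simp [runningMax]
  | succ n ih =>
    rw [birkhoffSum_succ']
    exact le_max_of_le_right (by linarith [ih (T x)])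

lemma runningMax_le {g : S → ℝ} {C : ℝ} (hC : ∀ x, |g x| ≤ C) (n : ℕ) (x : S) :
    runningMax T g n x ≤ n * C := by
  have h0 : 0 ≤ C := (abs_nonneg _).trans (hC x)
  induction n generalizing x with
  | zero => simp [runningMax]
  | succ n ih =>
    refine max_le (by positivity) ?_
    push_cast
    linarith [ih (T x), (abs_le.1 (hC x)).2]

variable [MeasurableSpace S] {ν : Measure S}

lemma measurable_runningMax (hT : Measurable T) {g : S → ℝ} (hg : Measurable g) (n : ℕ) :
    Measurable (runningMax T g n) := by
  induction n with
  | zero => exact measurable_const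
  | succ n ih => exact measurable_const.max (hg.add (ih.comp hT))

lemma integrable_of_abs_le [IsFiniteMeasure ν] {g : S → ℝ} (hg : Measurable g) {C : ℝ}
    (hC : ∀ x, |g x| ≤ C) : Integrable g ν :=
  Integrable.of_bound hg.aestronglyMeasurable C (Eventually.of_forall hC)

/-- The maximal ergodic inequality. -/
lemma setIntegral_runningMax_pos_nonneg [IsFiniteMeasure ν] (hT : MeasurePreserving T ν ν)
    {g : S → ℝ} (hg : Measurable g) {C : ℝ} (hC : ∀ x, |g x| ≤ C) (n : ℕ) :
    0 ≤ ∫ x in {x | 0 < runningMax T g n x}, g x ∂ν := by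
  set M := runningMax T g n with hM
  have hMm : Measurable M := measurable_runningMax hT.measurable hg n
  have hMi : Integrable M ν := integrable_of_abs_le hMm (C := n * C) fun x => by
    rw [abs_of_nonneg (runningMax_nonneg g n x)]; exact runningMax_le hC n x
  have hMTi : Integrable (fun x => M (T x)) ν := hT.integrable_comp_of_integrable hMi
  have hs : MeasurableSet {x | 0 < M x} := measurableSet_lt measurable_const hMm
  -- Garsia's argument: where the maximum M is positive it equals g plus an earlier maximum at T x,
  -- which is at most M (T x). Integrating, the left side vanishes by invariance.
  have key : ∀ x, M x - M (T x) ≤ Set.indicator {x | 0 < M x} g x := by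
    intro x
    by_cases hx : 0 < M x
    · rw [Set.indicator_of_mem (show x ∈ {x | 0 < M x} from hx)]
      cases n with
      | zero => simp [hM, runningMax] at hx
      | succ n =>
        have h1 : M x = g x + runningMax T g n (T x) := by
          have : M x = max 0 (g x + runningMax T g n (T x)) := rfl
          rcases max_choice 0 (g x + runningMax T g n (T x)) with h | h
          · rw [this, h] at hx; exact absurd hx (lt_irrefl _)
          · rw [this, h]
        have h2 : runningMax T g n (T x) ≤ M (T x) := runningMax_le_succ g n (T x)
        linarith
    · rw [Set.indicator_of_notMem (show x ∉ {x | 0 < M x} from hx)]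
      linarith [runningMax_nonneg (T := T) g n (T x)]
  rw [← integral_indicator hs]
  calc (0 : ℝ) = ∫ x, M x ∂ν - ∫ x, M (T x) ∂ν := by
        have := hT.map_eq ▸ integral_map hT.measurable.aemeasurable (f := M)
          (hMm.aestronglyMeasurable)
        rw [← this, sub_self]
    _ = ∫ x, (M x - M (T x)) ∂ν := (integral_sub hMi hMTi).symm
    _ ≤ _ := integral_mono (hMi.sub hMTi) ((integrable_of_abs_le hg hC).indicator hs) key

lemma integral_nonneg_of_ae_exists_runningMax_pos [IsFiniteMeasure ν]
    (hT : MeasurePreserving T ν ν) {g : S → ℝ} (hg : Measurable g) {C : ℝ}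
    (hC : ∀ x, |g x| ≤ C) (h : ∀ᵐ x ∂ν, ∃ n, 0 < runningMax T g n x) :
    0 ≤ ∫ x, g x ∂ν := by
  have hs : ∀ n, MeasurableSet {x | 0 < runningMax T g n x} := fun n =>
    measurableSet_lt measurable_const (measurable_runningMax hT.measurable hg n)
  have lim : Tendsto (fun n => ∫ x, Set.indicator {x | 0 < runningMax T g n x} g x ∂ν) atTop
      (𝓝 (∫ x, g x ∂ν)) := by
    refine tendsto_integral_of_dominated_convergence (fun _ => C)
      (fun n => (hg.indicator (hs n)).aestronglyMeasurable) (integrable_const _) ?_ ?_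
    · refine fun n => Eventually.of_forall fun x => ?_
      exact (norm_indicator_le_norm_self g x).trans (hC x)
    · filter_upwards [h] with x ⟨n, hn⟩
      refine tendsto_const_nhds.congr' ?_
      filter_upwards [eventually_ge_atTop n] with m hm
      have : runningMax T g n x ≤ runningMax T g m x :=
        monotone_nat_of_le_succ (fun k => runningMax_le_succ (T := T) g k x) hm
      rw [Set.indicator_of_mem]
      exact hn.trans_le this
  refine ge_of_tendsto lim (Eventually.of_forall fun n => ?_)
  rw [integral_indicator (hs n)]
  exact setIntegral_runningMax_pos_nonneg hT hg hC n

/-- Unboundedness of the sums is an invariant event, because the sums at x and T x differ by the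
bounded g x. By ergodicity it is null or full, and if full the maximal inequality would make the
mean nonnegative. -/
lemma ae_birkhoffSum_bddAbove [IsProbabilityMeasure ν] (hT : Ergodic T ν) {g : S → ℝ}
    (hg : Measurable g) {C : ℝ} (hC : ∀ x, |g x| ≤ C) (hneg : ∫ x, g x ∂ν < 0) :
    ∀ᵐ x ∂ν, ∃ K : ℕ, ∀ n, birkhoffSum T g n x ≤ K := by
  set E : Set S := {x | ∀ K : ℕ, ∃ n, (K : ℝ) < birkhoffSum T g n x} with hE
  have hm : ∀ n, Measurable (birkhoffSum T g n) := fun n =>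
    Finset.measurable_sum _ fun i _ => hg.comp (hT.measurable.iterate i)
  have hEm : MeasurableSet E := by
    have : E = ⋂ K : ℕ, ⋃ n, {x | (K : ℝ) < birkhoffSum T g n x} := by
      ext x; simp [hE]
    rw [this]
    exact MeasurableSet.iInter fun K => MeasurableSet.iUnion fun n =>
      measurableSet_lt measurable_const (hm n)
  have hinv : T ⁻¹' E = E := by
    ext x
    obtain ⟨c, hc⟩ := exists_nat_ge C
    have hb := abs_le.1 (hC x)
    constructor
    · intro h K
      obtain ⟨n, hn⟩ := h (K + c)
      refine ⟨n + 1, ?_⟩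
      rw [birkhoffSum_succ']
      push_cast at hn
      linarith
    · intro h K
      obtain ⟨n, hn⟩ := h (K + c)
      push_cast at hn
      cases n with
      | zero =>
        rw [birkhoffSum_zero] at hn
        have : (0 : ℝ) ≤ K + c := by positivity
        linarith
      | succ n =>
        refine ⟨n, ?_⟩
        rw [birkhoffSum_succ'] at hn
        linarith
  rcases hT.toPreErgodic.prob_eq_zero_or_one hEm hinv with h | h
  · have : ∀ᵐ x ∂ν, x ∉ E := measure_eq_zero_iff_ae_notMem.1 h
    filter_upwards [this] with x hx
    simp only [hE, Set.mem_ofPred_eq, not_forall, not_exists, not_lt] at hx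
    exact hx
  · exfalso
    have h1 : ∀ᵐ x ∂ν, x ∈ E := (mem_ae_iff_prob_eq_one hEm).2 h
    refine absurd (integral_nonneg_of_ae_exists_runningMax_pos hT.toMeasurePreserving hg hC ?_)
      (not_le.2 hneg)
    filter_upwards [h1] with x hx
    obtain ⟨n, hn⟩ := hx 0
    exact ⟨n, lt_of_lt_of_le (by simpa using hn) (birkhoffSum_le_runningMax g n x)⟩

/-- For b strictly between the mean and c, the sums of f - b are bounded by some K, so the averages
are at most b + K/n. -/
lemma ae_eventually_birkhoffAverage_lt [IsProbabilityMeasure ν] (hT : Ergodic T ν) {f : S → ℝ}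
    (hf : Measurable f) {C : ℝ} (hC : ∀ x, |f x| ≤ C) {c : ℝ} (hc : ∫ x, f x ∂ν < c) :
    ∀ᵐ x ∂ν, ∀ᶠ n : ℕ in atTop, birkhoffAverage ℝ T f n x < c := by
  obtain ⟨b, hb1, hb2⟩ := exists_between hc
  have hint : ∫ x, (f x - b) ∂ν < 0 := by
    rw [integral_sub (integrable_of_abs_le hf hC) (integrable_const _)]
    simpa using hb1
  have := ae_birkhoffSum_bddAbove hT (g := fun x => f x - b) (hf.sub_const b) (C := C + |b|)
    (fun x => (abs_sub _ _).trans (by linarith [hC x])) hint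
  filter_upwards [this] with x ⟨K, hK⟩
  have hsum : ∀ n, birkhoffSum T (fun x => f x - b) n x = birkhoffSum T f n x - n * b := by
    intro n
    simp [birkhoffSum, Finset.sum_sub_distrib]
  have hlim : Tendsto (fun n : ℕ => (K : ℝ) / (n : ℝ)) atTop (𝓝 0) :=
    tendsto_const_div_atTop_nhds_zero_nat _
  filter_upwards [hlim.eventually (gt_mem_nhds (sub_pos.2 hb2)), eventually_gt_atTop 0]
    with n hn hn0
  have hn0' : (0 : ℝ) < n := by exact_mod_cast hn0
  have h1 := hK n
  rw [hsum] at h1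
  rw [div_lt_iff₀ hn0'] at hn
  rw [birkhoffAverage, smul_eq_mul, inv_mul_lt_iff₀ hn0']
  linarith

/-- Birkhoff's pointwise ergodic theorem for bounded functions. -/
theorem ae_tendsto_birkhoffAverage [IsProbabilityMeasure ν] (hT : Ergodic T ν) {f : S → ℝ}
    (hf : Measurable f) {C : ℝ} (hC : ∀ x, |f x| ≤ C) :
    ∀ᵐ x ∂ν, Tendsto (fun n => birkhoffAverage ℝ T f n x) atTop (𝓝 (∫ x, f x ∂ν)) := by
  have h1 : ∀ᵐ x ∂ν, ∀ k : ℕ, ∀ᶠ n : ℕ in atTop,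
      birkhoffAverage ℝ T f n x < ∫ x, f x ∂ν + 1 / ((k : ℝ) + 1) :=
    ae_all_iff.2 fun k => ae_eventually_birkhoffAverage_lt hT hf hC (by
      have : 0 < 1 / ((k : ℝ) + 1) := by positivity
      linarith)
  have h2 : ∀ᵐ x ∂ν, ∀ k : ℕ, ∀ᶠ n : ℕ in atTop,
      birkhoffAverage ℝ T (fun x => - f x) n x < ∫ x, - f x ∂ν + 1 / ((k : ℝ) + 1) :=
    ae_all_iff.2 fun k => ae_eventually_birkhoffAverage_lt hT (f := fun x => - f x) hf.neg
      (C := C) (fun x => by rw [abs_neg]; exact hC x) (by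
      have : 0 < 1 / ((k : ℝ) + 1) := by positivity
      linarith)
  filter_upwards [h1, h2] with x hx1 hx2
  rw [tendsto_order]
  have hneg : ∀ n, birkhoffAverage ℝ T (fun x => - f x) n x = - birkhoffAverage ℝ T f n x := by
    intro n
    simp [birkhoffAverage, birkhoffSum]
  constructor
  · intro a ha
    obtain ⟨k, hk⟩ := exists_nat_one_div_lt (sub_pos.2 ha)
    filter_upwards [hx2 k] with n hn
    rw [hneg, integral_neg] at hn
    linarith
  · intro a ha
    obtain ⟨k, hk⟩ := exists_nat_one_div_lt (sub_pos.2 ha)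
    filter_upwards [hx1 k] with n hn
    linarith

end Birkhoff

/-! ### Blocks and the shift -/

section Blocks

variable {A : Type*}

@[simp] lemma length_block (x : ℤ → A) (m : ℤ) (k : ℕ) : (block x m k).length = k := by
  simp [block]

@[simp] lemma block_zero (x : ℤ → A) (m : ℤ) : block x m 0 = [] := by
  simp [block]

lemma block_succ (x : ℤ → A) (m : ℤ) (k : ℕ) :
    block x m (k + 1) = block x (m - 1) k ++ [x m] := by
  simp only [block, List.ofFn_succ', List.concat_eq_append]
  congr 2
  · funext i; congr 1; simp only [Fin.val_castSucc]; push_cast; ring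
  · congr 1; simp only [Fin.val_last]; push_cast; ring

lemma block_add (x : ℤ → A) (m : ℤ) (k l : ℕ) :
    block x m (k + l) = block x (m - l) k ++ block x m l := by
  induction l generalizing m with
  | zero => simp
  | succ l ih =>
    rw [← add_assoc, block_succ, ih, block_succ, List.append_assoc]
    congr 2; push_cast; ring

lemma block_shift (x : ℤ → A) (n m : ℤ) (k : ℕ) :
    block (shift n x) m k = block x (m + n) k := by
  simp only [block, shift]
  congr 1; funext i; congr 1; ring

lemma suffix_block_iff {v : List A} {x : ℤ → A} {m : ℤ} {k : ℕ} :
    v <:+ block x m k ↔ v.length ≤ k ∧ block x m v.length = v := by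
  constructor
  · intro h
    have hl : v.length ≤ k := by simpa using h.length_le
    refine ⟨hl, ?_⟩
    obtain ⟨d, rfl⟩ := Nat.exists_eq_add_of_le' hl
    rw [block_add] at h
    have h2 : block x m v.length <:+ block x (m - v.length) d ++ block x m v.length :=
      List.suffix_append _ _
    exact ((List.suffix_of_suffix_length_le h h2 (by simp)).eq_of_length (by simp)).symm
  · rintro ⟨hl, h⟩
    obtain ⟨d, rfl⟩ := Nat.exists_eq_add_of_le' hl
    rw [block_add, h]
    exact List.suffix_append _ _

lemma block_eq_append_singleton {v : List A} {a : A} {x : ℤ → A} {m : ℤ} :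
    block x m (v ++ [a]).length = v ++ [a] ↔ block x (m - 1) v.length = v ∧ x m = a := by
  rw [List.length_append, List.length_singleton, block_succ]
  constructor
  · intro h
    have := List.append_inj h (by simp)
    exact ⟨this.1, by simpa using this.2⟩
  · rintro ⟨h, rfl⟩
    rw [h]

lemma iterate_shift (n : ℕ) : (shift (A := A) 1)^[n] = shift n := by
  induction n with
  | zero => funext x t; simp [shift]
  | succ n ih =>
    rw [Function.iterate_succ', ih]
    funext x t
    simp only [Function.comp, shift]
    congr 1; push_cast; ring

end Blocks

/-! ### Word probabilities of a stationary ergodic law -/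

section Law

variable {A : Type*}

/-- The set of paths in which the word `v` ends at time `i`. -/
def cylinder (i : ℤ) (v : List A) : Set (ℤ → A) := {x | block x i v.length = v}

lemma cylinder_append_singleton (i : ℤ) (v : List A) (a : A) :
    cylinder i (v ++ [a]) = cylinder (i - 1) v ∩ {x | x i = a} := by
  ext x
  exact block_eq_append_singleton

variable [MeasurableSpace A] {ν : Measure (ℤ → A)}

/-- The probability of the word `v` under the law `ν`. -/
def lawProb (ν : Measure (ℤ → A)) (v : List A) : ℝ := ν.real (cylinder 0 v)

/-- The probability of the letter `a` after the word `v` under the law `ν`. -/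
def transProb (ν : Measure (ℤ → A)) (v : List A) (a : A) : ℝ :=
  lawProb ν (v ++ [a]) / lawProb ν v

/-- The past before `v` is irrelevant under the law `ν`. -/
def IsMemoryWord (ν : Measure (ℤ → A)) (v : List A) : Prop :=
  ∀ (z : List A) (a : A), 1 ≤ z.length → 0 < lawProb ν (z ++ v ++ [a]) →
    transProb ν v a = transProb ν (z ++ v) a

lemma lawProb_nonneg (v : List A) : 0 ≤ lawProb ν v := measureReal_nonneg

lemma transProb_nonneg (v : List A) (a : A) : 0 ≤ transProb ν v a :=
  div_nonneg (lawProb_nonneg _) (lawProb_nonneg _)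

section Probability

variable [IsProbabilityMeasure ν]

open scoped Classical in
/-- Frequencies of visits converge to probabilities, finitely many times being irrelevant. -/
lemma ae_tendsto_frequency (hT : Ergodic (shift 1) ν) {V : Set (ℤ → A)} (hV : MeasurableSet V) :
    ∀ᵐ x ∂ν, ∀ (Q : ℕ → Prop) (L : ℕ), (∀ m, L ≤ m → (Q m ↔ shift m x ∈ V)) →
      Tendsto (fun n : ℕ => (((Finset.range n).filter Q).card : ℝ) / n) atTop
        (𝓝 (ν.real V)) := by
  have hb := ae_tendsto_birkhoffAverage hT (f := V.indicator fun _ => (1 : ℝ))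
    (measurable_const.indicator hV) (C := 1) (fun x => by
      by_cases h : x ∈ V <;> simp [h])
  rw [integral_indicator hV] at hb
  simp only [integral_const, smul_eq_mul, mul_one, measureReal_restrict_apply_univ] at hb
  filter_upwards [hb] with x hx Q L hQ
  have hS : ∀ n, birkhoffAverage ℝ (shift 1) (V.indicator fun _ => (1 : ℝ)) n x =
      (((Finset.range n).filter fun m : ℕ => shift m x ∈ V).card : ℝ) / n := by
    intro n
    rw [birkhoffAverage, birkhoffSum, smul_eq_mul, inv_mul_eq_div, Finset.card_filter]
    push_cast
    congr 1
    refine Finset.sum_congr rfl fun m _ => ?_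
    rw [iterate_shift, Set.indicator_apply]
  simp only [hS] at hx
  refine tendsto_of_tendsto_of_dist hx ?_
  refine squeeze_zero (fun _ => dist_nonneg) (fun n => ?_)
    (tendsto_const_div_atTop_nhds_zero_nat (L : ℝ))
  rw [Real.dist_eq, ← sub_div, abs_div, Nat.abs_cast]
  refine div_le_div_of_nonneg_right ?_ (Nat.cast_nonneg _)
  have key : ∀ P P' : ℕ → Prop, (∀ m, L ≤ m → (P m ↔ P' m)) →
      (((Finset.range n).filter P).card : ℝ) ≤ ((Finset.range n).filter P').card + L := by
    intro P P' h
    have : (Finset.range n).filter P ⊆ (Finset.range n).filter P' ∪ Finset.range L := by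
      intro m hm
      simp only [Finset.mem_union, Finset.mem_filter, Finset.mem_range] at hm ⊢
      by_cases hmL : m < L
      · exact Or.inr hmL
      · exact Or.inl ⟨hm.1, (h m (not_lt.1 hmL)).1 hm.2⟩
    have h2 := (Finset.card_le_card this).trans (Finset.card_union_le _ _)
    rw [Finset.card_range] at h2
    exact_mod_cast h2
  rw [abs_le]
  constructor
  · linarith [key Q (fun m => shift m x ∈ V) hQ]
  · linarith [key (fun m => shift m x ∈ V) Q fun m hm => (hQ m hm).symm]

end Probability

variable [Countable A] [DiscreteMeasurableSpace A]

lemma measurableSet_block (i : ℤ) (k : ℕ) (P : List A → Prop) :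
    MeasurableSet {x : ℤ → A | P (block x i k)} := by
  have h : Measurable fun (x : ℤ → A) (j : Fin k) => x (i - k + 1 + (j : ℕ)) :=
    measurable_pi_lambda _ fun j => measurable_pi_apply _
  exact h (MeasurableSet.of_discrete (s := {f : Fin k → A | P (List.ofFn f)}))

lemma measurableSet_cylinder (i : ℤ) (v : List A) : MeasurableSet (cylinder i v) :=
  measurableSet_block i v.length (· = v)

lemma measurable_of_factorsThrough_block {B : Type*} [MeasurableSpace B] {f : (ℤ → A) → B}
    {i : ℤ} {k : ℕ} (h : ∀ x y, block x i k = block y i k → f x = f y) : Measurable f := by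
  intro s _
  have : f ⁻¹' s = {x | ∃ y, f y ∈ s ∧ block y i k = block x i k} := by
    ext x
    exact ⟨fun hx => ⟨x, hx, rfl⟩, fun ⟨y, hy, hyx⟩ => by
      rw [Set.mem_preimage, ← h y x hyx]; exact hy⟩
  rw [this]
  exact measurableSet_block i k fun v => ∃ y, f y ∈ s ∧ block y i k = v

lemma measure_cylinder_add_nat (hT : MeasurePreserving (shift 1) ν ν) (i : ℤ) (d : ℕ)
    (v : List A) : ν (cylinder (i + d) v) = ν (cylinder i v) := by
  have h := (hT.iterate d).measure_preimage (measurableSet_cylinder i v).nullMeasurableSet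
  rw [← h, iterate_shift]
  congr 1
  ext x
  simp only [cylinder, Set.mem_preimage, Set.mem_ofPred_eq, block_shift]

lemma measureReal_cylinder (hT : MeasurePreserving (shift 1) ν ν) (i : ℤ) (v : List A) :
    ν.real (cylinder i v) = lawProb ν v := by
  rw [lawProb, measureReal_def, measureReal_def]
  congr 1
  obtain ⟨d, rfl | rfl⟩ := i.eq_nat_or_neg
  · simpa using measure_cylinder_add_nat hT 0 d v
  · simpa using (measure_cylinder_add_nat hT (-(d : ℤ)) d v).symm

variable [IsProbabilityMeasure ν]

lemma hasSum_lawProb_append (hT : MeasurePreserving (shift 1) ν ν) (v : List A) :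
    HasSum (fun a => lawProb ν (v ++ [a])) (lawProb ν v) := by
  have hU : cylinder (-1) v = ⋃ a, cylinder 0 (v ++ [a]) := by
    ext x
    simp [cylinder_append_singleton]
  have h := measure_iUnion (μ := ν) (f := fun a => cylinder 0 (v ++ [a]))
    (fun a b hab => Set.disjoint_left.2 fun x hx hy => hab (by
      simp only [cylinder_append_singleton] at hx hy
      exact hx.2.symm.trans hy.2))
    (fun a => measurableSet_cylinder _ _)
  have := ENNReal.hasSum_toReal (f := fun a => ν (cylinder 0 (v ++ [a]))) (by
    rw [← h]; exact measure_ne_top _ _)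
  rw [← ENNReal.tsum_toReal_eq (fun a => measure_ne_top _ _), ← h, ← hU, ← measureReal_def,
    measureReal_cylinder hT] at this
  exact this

lemma hasSum_transProb (hT : MeasurePreserving (shift 1) ν ν) {v : List A}
    (hv : 0 < lawProb ν v) : HasSum (transProb ν v) 1 := by
  have := (hasSum_lawProb_append hT v).div_const (lawProb ν v)
  rwa [div_self hv.ne'] at this

lemma transProb_le_one (hT : MeasurePreserving (shift 1) ν ν) {v : List A} (a : A) :
    transProb ν v a ≤ 1 := by
  refine div_le_one_of_le₀ ?_ (lawProb_nonneg _)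
  exact le_hasSum (hasSum_lawProb_append hT v) a fun b _ => lawProb_nonneg _

/-- After a word ending in a memory word `w`, the next letter has the law prescribed by `w`. -/
lemma IsMemoryWord.lawProb_append (hT : MeasurePreserving (shift 1) ν ν) {w : List A}
    (hw : IsMemoryWord ν w) (hpos : 0 < lawProb ν w) {u : List A} (hu : w <:+ u) (a : A) :
    lawProb ν (u ++ [a]) = lawProb ν u * transProb ν w a := by
  -- A memory word only constrains letters b with p(ub) > 0; for the others p(ub) = 0, so an
  -- inequality holds for every letter. Both sides sum to p(u) over the alphabet, which forces
  -- equality.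
  have hle : ∀ b, lawProb ν (u ++ [b]) ≤ lawProb ν u * transProb ν w b := by
    intro b
    rcases (lawProb_nonneg (ν := ν) (u ++ [b])).eq_or_lt with h0 | h0
    · rw [← h0]
      exact mul_nonneg (lawProb_nonneg _) (transProb_nonneg _ _)
    · obtain ⟨z, rfl⟩ := hu
      have hu0 : 0 < lawProb ν (z ++ w) := h0.trans_le
        (le_hasSum (hasSum_lawProb_append hT (z ++ w)) b fun _ _ => lawProb_nonneg _)
      have : transProb ν w b = transProb ν (z ++ w) b := by
        cases z with
        | nil => rfl
        | cons c z => exact hw _ b (by simp) h0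
      rw [this, transProb, mul_div_cancel₀ _ hu0.ne']
  have h1 := ((hasSum_transProb hT hpos).mul_left (lawProb ν u)).sub (hasSum_lawProb_append hT u)
  rw [mul_one, sub_self] at h1
  have h2 := (hasSum_zero_iff_of_nonneg fun b => sub_nonneg.2 (hle b)).1 h1
  have := congrFun h2 a
  simp only [Pi.zero_apply] at this
  linarith

end Law

/-! ### A self-normalized exponential inequality -/

/-- This is the one-step supermartingale bound for a centred Bernoulli variable. In e^y ≤ 1 + y + y²
the linear terms cancel on averaging, leaving 1 + l² q(1-q) ≤ e^{l²}. -/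
lemma bernoulli_exp_le {q l : ℝ} (hq0 : 0 ≤ q) (hq1 : q ≤ 1) (hl : |l| ≤ 1) :
    q * Real.exp (l * (1 - q) - l ^ 2) + (1 - q) * Real.exp (l * (0 - q) - l ^ 2) ≤ 1 := by
  have hexp : ∀ y : ℝ, |y| ≤ 1 → Real.exp y ≤ 1 + y + y ^ 2 := fun y hy => by
    have := (abs_le.1 (Real.abs_exp_sub_one_sub_id_le hy)).2
    linarith
  have b1 : |l * (1 - q)| ≤ 1 := by
    rw [abs_mul, abs_of_nonneg (by linarith : 0 ≤ 1 - q)]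
    exact mul_le_one₀ hl (by linarith) (by linarith)
  have b2 : |l * (0 - q)| ≤ 1 := by
    rw [abs_mul, zero_sub, abs_neg, abs_of_nonneg hq0]
    exact mul_le_one₀ hl hq0 hq1
  have h1 := mul_le_mul_of_nonneg_left (hexp _ b1) hq0
  have h2 := mul_le_mul_of_nonneg_left (hexp _ b2) (by linarith : 0 ≤ 1 - q)
  have h3 : q * Real.exp (l * (1 - q)) + (1 - q) * Real.exp (l * (0 - q)) ≤ Real.exp (l ^ 2) := by
    have h4 := Real.add_one_le_exp (l ^ 2)
    have h5 : l ^ 2 * (q * (1 - q)) ≤ l ^ 2 * 1 :=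
      mul_le_mul_of_nonneg_left (by nlinarith) (sq_nonneg l)
    nlinarith
  rw [sub_eq_add_neg, sub_eq_add_neg (l * (0 - q)), Real.exp_add, Real.exp_add, ← mul_assoc,
    ← mul_assoc, ← add_mul]
  calc _ ≤ Real.exp (l ^ 2) * Real.exp (-l ^ 2) :=
        mul_le_mul_of_nonneg_right h3 (Real.exp_pos _).le
    _ = 1 := by rw [← Real.exp_add]; simp

section Martingale

variable {A : Type*}

/-- The word `x_0^{j-1}` of the first `j` letters. -/
def initialWord (x : ℤ → A) (j : ℕ) : List A := block x ((j : ℤ) - 1) j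

lemma initialWord_succ (x : ℤ → A) (j : ℕ) : initialWord x (j + 1) = initialWord x j ++ [x j] := by
  rw [initialWord, initialWord, block_succ]
  simp

lemma initialWord_eq_succ_iff {x y : ℤ → A} {j : ℕ} :
    initialWord x (j + 1) = initialWord y (j + 1) ↔
      initialWord x j = initialWord y j ∧ x j = y j := by
  rw [initialWord_succ, initialWord_succ]
  constructor
  · intro h
    have := List.append_inj h (by simp [initialWord])
    exact ⟨this.1, by simpa using this.2⟩
  · rintro ⟨h1, h2⟩
    rw [h1, h2]

lemma initialWord_eq_of_le {x y : ℤ → A} {i j : ℕ} (hij : i ≤ j)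
    (h : initialWord x j = initialWord y j) : initialWord x i = initialWord y i := by
  induction j, hij using Nat.le_induction with
  | base => exact h
  | succ j _ ih => exact ih (initialWord_eq_succ_iff.1 h).1

lemma eq_of_initialWord_eq {x y : ℤ → A} {i j : ℕ} (hij : i < j)
    (h : initialWord x j = initialWord y j) : x i = y i :=
  (initialWord_eq_succ_iff.1 (initialWord_eq_of_le hij h)).2

open scoped Classical in
/-- The deviation `1{x_j = a_j} - q(a_j)` at the selected times, `0` elsewhere. -/
def deviation (q : A → ℝ) (C : ℕ → (ℤ → A) → Prop) (a : ℕ → (ℤ → A) → A) (j : ℕ) (x : ℤ → A) :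
    ℝ :=
  if C j x then (if x j = a j x then 1 else 0) - q (a j x) else 0

open scoped Classical in
/-- The indicator that time `j` is selected. -/
def selected (C : ℕ → (ℤ → A) → Prop) (j : ℕ) (x : ℤ → A) : ℝ := if C j x then 1 else 0

/-- The selection of time `j` and the letter predicted at that time only depend on
`x_0^{j-1}`. -/
def IsPredictable (C : ℕ → (ℤ → A) → Prop) (a : ℕ → (ℤ → A) → A) : Prop :=
  ∀ j x y, initialWord x j = initialWord y j → C j x → C j y ∧ a j x = a j y

variable {q : A → ℝ} {C : ℕ → (ℤ → A) → Prop} {a : ℕ → (ℤ → A) → A}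

lemma IsPredictable.selected_congr (hC : IsPredictable C a) {j : ℕ} {x y : ℤ → A}
    (h : initialWord x j = initialWord y j) : selected C j x = selected C j y := by
  have : C j x ↔ C j y := ⟨fun hx => (hC j x y h hx).1, fun hy => (hC j y x h.symm hy).1⟩
  by_cases hx : C j x
  · simp [selected, hx, this.1 hx]
  · simp [selected, hx, mt this.2 hx]

lemma IsPredictable.deviation_congr (hC : IsPredictable C a) {j : ℕ} {x y : ℤ → A}
    (h : initialWord x (j + 1) = initialWord y (j + 1)) :
    deviation q C a j x = deviation q C a j y := by
  obtain ⟨h1, h2⟩ := initialWord_eq_succ_iff.1 h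
  by_cases hx : C j x
  · obtain ⟨hy, ha⟩ := hC j x y h1 hx
    rw [deviation, deviation, if_pos hx, if_pos hy, ha]
    by_cases hb : x j = a j y
    · rw [if_pos hb, if_pos (h2 ▸ hb)]
    · rw [if_neg hb, if_neg (h2 ▸ hb)]
  · have hy : ¬ C j y := fun hy => hx (hC j y x h1.symm hy).1
    simp [deviation, hx, hy]

/-- The exponential process attached to the deviations. -/
def expProcess (q : A → ℝ) (C : ℕ → (ℤ → A) → Prop) (a : ℕ → (ℤ → A) → A) (l : ℝ) (n : ℕ)
    (x : ℤ → A) : ℝ≥0∞ :=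
  ∏ j ∈ Finset.range n, ENNReal.ofReal (Real.exp (l * deviation q C a j x - l ^ 2 * selected C j x))

lemma expProcess_eq (l : ℝ) (n : ℕ) (x : ℤ → A) :
    expProcess q C a l n x = ENNReal.ofReal (Real.exp
      (l * ∑ j ∈ Finset.range n, deviation q C a j x
        - l ^ 2 * ∑ j ∈ Finset.range n, selected C j x)) := by
  rw [expProcess, ← ENNReal.ofReal_prod_of_nonneg (fun _ _ => (Real.exp_pos _).le),
    ← Real.exp_sum, Finset.sum_sub_distrib, Finset.mul_sum, Finset.mul_sum]

lemma IsPredictable.expProcess_congr (hC : IsPredictable C a) {l : ℝ} {n : ℕ} {x y : ℤ → A}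
    (h : initialWord x n = initialWord y n) :
    expProcess q C a l n x = expProcess q C a l n y := by
  refine Finset.prod_congr rfl fun j hj => ?_
  have hj' := initialWord_eq_of_le (Finset.mem_range.1 hj) h
  rw [hC.deviation_congr hj', hC.selected_congr (initialWord_eq_succ_iff.1 hj').1]

variable [MeasurableSpace A] [Countable A] [DiscreteMeasurableSpace A]
  {ν : Measure (ℤ → A)} [IsProbabilityMeasure ν]

/-- On an atom of the past x_0^{j-1}, either time j is not selected and the factor is 1, or the past
ends in `w` and the letter at time j equals the predicted one with conditional probability p(· | w),
so the Bernoulli bound applies. -/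
lemma setLIntegral_exp_deviation_le (hT : MeasurePreserving (shift 1) ν ν) {w : List A}
    (hw : IsMemoryWord ν w) (hpos : 0 < lawProb ν w) (hC : IsPredictable C a)
    (hCw : ∀ j x, C j x → w <:+ initialWord x j) {l : ℝ} (hl : |l| ≤ 1) (j : ℕ) (y : ℤ → A) :
    ∫⁻ x in {x | initialWord x j = initialWord y j}, ENNReal.ofReal (Real.exp
      (l * deviation (transProb ν w) C a j x - l ^ 2 * selected C j x)) ∂ν ≤
      ν {x | initialWord x j = initialWord y j} := by
  set F := {x | initialWord x j = initialWord y j} with hF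
  have hFm : MeasurableSet F := measurableSet_block _ _ (· = initialWord y j)
  by_cases hy : C j y
  · set b := a j y with hb
    set q := transProb ν w b with hq
    have hFc : F = cylinder ((j : ℤ) - 1) (initialWord y j) := by
      ext x; simp [hF, cylinder, initialWord]
    have hpF : ν.real F = lawProb ν (initialWord y j) := by
      rw [hFc, measureReal_cylinder hT]
    have hBm : MeasurableSet {x : ℤ → A | x j = b} :=
      (measurable_pi_apply (j : ℤ) : Measurable fun x : ℤ → A => x j)
        (MeasurableSet.of_discrete (s := {b}))
    have hpB : ν.real (F ∩ {x | x j = b}) = ν.real F * q := by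
      rw [hpF, ← hw.lawProb_append hT hpos (hCw j y hy), hFc, ← cylinder_append_singleton,
        measureReal_cylinder hT]
    have hpB' : ν.real (F \ {x | x j = b}) = ν.real F * (1 - q) := by
      have := measureReal_inter_add_sdiff (μ := ν) (s := F) hBm
      rw [hpB] at this
      linarith
    have h1 : ∫⁻ x in F ∩ {x | x j = b}, ENNReal.ofReal (Real.exp
        (l * deviation (transProb ν w) C a j x - l ^ 2 * selected C j x)) ∂ν =
        ENNReal.ofReal (Real.exp (l * (1 - q) - l ^ 2)) * ν (F ∩ {x | x j = b}) := by
      rw [← setLIntegral_const]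
      refine setLIntegral_congr_fun (hFm.inter hBm) fun x hx => ?_
      obtain ⟨hCx, hax⟩ := hC j y x hx.1.symm hy
      have hxb : x j = a j x := by rw [← hax]; exact hx.2
      simp only [deviation, selected, if_pos hCx, if_pos hxb, mul_one]
      rw [← hax]
    have h0 : ∫⁻ x in F \ {x | x j = b}, ENNReal.ofReal (Real.exp
        (l * deviation (transProb ν w) C a j x - l ^ 2 * selected C j x)) ∂ν =
        ENNReal.ofReal (Real.exp (l * (0 - q) - l ^ 2)) * ν (F \ {x | x j = b}) := by
      rw [← setLIntegral_const]
      refine setLIntegral_congr_fun (hFm.diff hBm) fun x hx => ?_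
      obtain ⟨hCx, hax⟩ := hC j y x hx.1.symm hy
      have hxb : x j ≠ a j x := by rw [← hax]; exact hx.2
      simp only [deviation, selected, if_pos hCx, if_neg hxb, mul_one]
      rw [← hax]
    rw [← lintegral_inter_add_sdiff _ F hBm, h1, h0, ← ofReal_measureReal (μ := ν) (s := F ∩ _),
      ← ofReal_measureReal (μ := ν) (s := F \ _), ← ofReal_measureReal (μ := ν) (s := F), hpB, hpB',
      ← ENNReal.ofReal_mul (Real.exp_pos _).le, ← ENNReal.ofReal_mul (Real.exp_pos _).le,
      ← ENNReal.ofReal_add]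
    · refine ENNReal.ofReal_le_ofReal ?_
      have hm := mul_le_mul_of_nonneg_left
        (bernoulli_exp_le (transProb_nonneg w b) (transProb_le_one hT b) hl)
        (measureReal_nonneg (μ := ν) (s := F))
      rw [mul_one] at hm
      refine le_trans (le_of_eq ?_) hm
      ring
    · exact mul_nonneg (Real.exp_pos _).le (mul_nonneg measureReal_nonneg (transProb_nonneg w b))
    · exact mul_nonneg (Real.exp_pos _).le (mul_nonneg measureReal_nonneg
        (by linarith [transProb_le_one (ν := ν) hT (v := w) b]))
  · rw [← setLIntegral_one]
    refine le_of_eq (setLIntegral_congr_fun hFm fun x hx => ?_)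
    have hx' : ¬ C j x := fun h => hy (hC j x y hx h).1
    simp [deviation, selected, hx']

/-- The supermartingale property, obtained without conditional expectations: the space splits into
the countably many atoms of x_0^{n-1}, on each of which the first n factors are constant. -/
lemma lintegral_expProcess_le_one (hT : MeasurePreserving (shift 1) ν ν) {w : List A}
    (hw : IsMemoryWord ν w) (hpos : 0 < lawProb ν w) (hC : IsPredictable C a)
    (hCw : ∀ j x, C j x → w <:+ initialWord x j) {l : ℝ} (hl : |l| ≤ 1) (n : ℕ) :
    ∫⁻ x, expProcess (transProb ν w) C a l n x ∂ν ≤ 1 := by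
  induction n with
  | zero => simp [expProcess]
  | succ n ih =>
    refine le_trans ?_ ih
    have hFm : ∀ u : List A, MeasurableSet {x | initialWord x n = u} := fun u =>
      measurableSet_block _ _ (· = u)
    have huniv : (Set.univ : Set (ℤ → A)) = ⋃ u : List A, {x | initialWord x n = u} := by
      ext x; simp
    have hdisj : Pairwise (Function.onFun Disjoint
        fun u : List A => {x : ℤ → A | initialWord x n = u}) := fun u v huv =>
      Set.disjoint_left.2 fun x hx hy => huv (Eq.trans (Eq.symm hx) hy)
    rw [← setLIntegral_univ, ← setLIntegral_univ (fun x => expProcess _ C a l n x), huniv,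
      lintegral_iUnion hFm hdisj, lintegral_iUnion hFm hdisj]
    refine ENNReal.tsum_le_tsum fun u => ?_
    rcases Set.eq_empty_or_nonempty {x : ℤ → A | initialWord x n = u} with he | ⟨y, rfl⟩
    · simp [he]
    · have h1 : ∫⁻ x in {x | initialWord x n = initialWord y n},
          expProcess (transProb ν w) C a l n x ∂ν =
          expProcess (transProb ν w) C a l n y * ν {x | initialWord x n = initialWord y n} := by
        rw [← setLIntegral_const]
        exact setLIntegral_congr_fun (hFm _) fun x hx => hC.expProcess_congr hx
      have h2 : ∫⁻ x in {x | initialWord x n = initialWord y n},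
          expProcess (transProb ν w) C a l (n + 1) x ∂ν =
          expProcess (transProb ν w) C a l n y *
          ∫⁻ x in {x | initialWord x n = initialWord y n}, ENNReal.ofReal (Real.exp
            (l * deviation (transProb ν w) C a n x - l ^ 2 * selected C n x)) ∂ν := by
        rw [← lintegral_const_mul']
        · refine setLIntegral_congr_fun (hFm _) fun x hx => ?_
          rw [← hC.expProcess_congr hx, expProcess, Finset.prod_range_succ, expProcess]
        · rw [expProcess_eq]; exact ENNReal.ofReal_ne_top
      rw [h1, h2]
      exact mul_le_mul_right (setLIntegral_exp_deviation_le hT hw hpos hC hCw hl n y) _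

/-- The probability that the empirical conditional frequencies along the selected times deviate
from the transition probabilities of the memory word `w`, in the direction `s`. -/
theorem measure_deviation_le (hT : MeasurePreserving (shift 1) ν ν) {w : List A}
    (hw : IsMemoryWord ν w) (hpos : 0 < lawProb ν w) (hC : IsPredictable C a)
    (hCw : ∀ j x, C j x → w <:+ initialWord x j) {s : ℝ} (hs : |s| = 1) {d N : ℝ} (hd0 : 0 ≤ d)
    (hd1 : d ≤ 1) (n : ℕ) :
    ν {x | N ≤ ∑ j ∈ Finset.range n, selected C j x ∧
        d * ∑ j ∈ Finset.range n, selected C j x ≤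
          s * ∑ j ∈ Finset.range n, deviation (transProb ν w) C a j x} ≤
      ENNReal.ofReal (Real.exp (-(N * d ^ 2 / 4))) := by
  -- This l maximizes the exponent: with S the number of selected times, on the event it is at least
  -- (d/2)·dS - (d²/4)S = d²S/4 ≥ Nd²/4. Only the lower bound N on the random S enters, and Markov's
  -- inequality concludes.
  set l := s * (d / 2) with hl
  have hl1 : |l| ≤ 1 := by
    rw [hl, abs_mul, hs, one_mul, abs_of_nonneg (by positivity)]; linarith
  have hs2 : s ^ 2 = 1 := by rw [← sq_abs, hs, one_pow]
  have hm : Measurable (expProcess (transProb ν w) C a l n) :=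
    measurable_of_factorsThrough_block (i := (n : ℤ) - 1) (k := n) fun x y h =>
      hC.expProcess_congr h
  have hM := mul_meas_ge_le_lintegral (μ := ν) hm (ENNReal.ofReal (Real.exp (N * d ^ 2 / 4)))
  have hM1 := hM.trans (lintegral_expProcess_le_one hT hw hpos hC hCw hl1 n)
  have hsub : {x | N ≤ ∑ j ∈ Finset.range n, selected C j x ∧
        d * ∑ j ∈ Finset.range n, selected C j x ≤
          s * ∑ j ∈ Finset.range n, deviation (transProb ν w) C a j x} ⊆
      {x | ENNReal.ofReal (Real.exp (N * d ^ 2 / 4)) ≤ expProcess (transProb ν w) C a l n x} := by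
    rintro x ⟨h1, h2⟩
    rw [Set.mem_ofPred_eq, expProcess_eq]
    refine ENNReal.ofReal_le_ofReal (Real.exp_le_exp.2 ?_)
    have e1 : l ^ 2 = d ^ 2 / 4 := by rw [hl, mul_pow, hs2]; ring
    rw [e1, hl]
    have h3 := mul_le_mul_of_nonneg_left h2 (by positivity : 0 ≤ d / 2)
    have h4 := mul_le_mul_of_nonneg_left h1 (by positivity : 0 ≤ d ^ 2 / 4)
    nlinarith
  rw [Real.exp_neg, ENNReal.ofReal_inv_of_pos (Real.exp_pos _)]
  refine (measure_mono hsub).trans ?_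
  rw [ENNReal.le_inv_iff_mul_le, mul_comm]
  exact hM1

end Martingale

/-! ### Empirical probabilities as visit counts -/

section Counts

variable {A : Type*}

lemma append_singleton_suffix_initialWord {v : List A} {a : A} {x : ℤ → A} {j : ℕ} :
    v ++ [a] <:+ initialWord x (j + 1) ↔ v <:+ initialWord x j ∧ x j = a := by
  rw [initialWord_succ]
  constructor
  · rintro ⟨z, hz⟩
    rw [← List.append_assoc] at hz
    have := List.append_inj' hz (by simp)
    exact ⟨⟨z, this.1⟩, by simpa using this.2.symm⟩
  · rintro ⟨⟨z, hz⟩, rfl⟩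
    exact ⟨z, by rw [← hz, List.append_assoc]⟩

lemma suffix_initialWord_iff {v : List A} {x : ℤ → A} {j : ℕ} :
    v <:+ initialWord x j ↔ v.length ≤ j ∧ block x ((j : ℤ) - 1) v.length = v :=
  suffix_block_iff

lemma suffix_initialWord_succ_iff {v : List A} {x : ℤ → A} {j : ℕ} :
    v <:+ initialWord x (j + 1) ↔ v.length ≤ j + 1 ∧ block x j v.length = v := by
  rw [suffix_initialWord_iff]
  simp

lemma mem_occurrences {n j : ℕ} {x : ℤ → A} {u : List A} :
    j ∈ occurrences n x u ↔ j ≤ n ∧ u <:+ initialWord x (j + 1) := by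
  rw [suffix_initialWord_succ_iff]
  simp [occurrences]

lemma occurrences_subset_of_suffix {n : ℕ} {x : ℤ → A} {u v : List A} (h : u <:+ v) :
    occurrences n x v ⊆ occurrences n x u := fun _ hj =>
  mem_occurrences.2 ⟨(mem_occurrences.1 hj).1, h.trans (mem_occurrences.1 hj).2⟩

open scoped Classical in
/-- The times `j ≤ n` that are immediately preceded by the word `v` within `x_0^n`. -/
def visits (n : ℕ) (x : ℤ → A) (v : List A) : Finset ℕ :=
  (Finset.range (n + 1)).filter fun j => v <:+ initialWord x j

lemma mem_visits {n j : ℕ} {x : ℤ → A} {v : List A} :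
    j ∈ visits n x v ↔ j ≤ n ∧ v <:+ initialWord x j := by
  simp [visits]

lemma mem_occurrences_append_singleton {n j : ℕ} {x : ℤ → A} {v : List A} {a : A} :
    j ∈ occurrences n x (v ++ [a]) ↔ j ∈ visits n x v ∧ x j = a := by
  rw [mem_occurrences, append_singleton_suffix_initialWord, mem_visits, and_assoc]

lemma occurrences_append_singleton_subset {n : ℕ} {x : ℤ → A} {v : List A} {a : A} :
    occurrences n x (v ++ [a]) ⊆ visits n x v := fun _ hj =>
  (mem_occurrences_append_singleton.1 hj).1

lemma card_eq_of_translate {s : Finset ℤ} {O : Finset ℕ} (c : ℤ)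
    (h : ∀ t ∈ s, ∃ j ∈ O, (j : ℤ) = t + c) (h' : ∀ j ∈ O, (j : ℤ) - c ∈ s) :
    s.card = O.card := by
  refine (Finset.card_bij (fun (j : ℕ) _ => (j : ℤ) - c) (fun j hj => h' j hj)
    (fun j _ k _ hjk => by omega) fun t ht => ?_).symm
  obtain ⟨j, hj, hjt⟩ := h t ht
  exact ⟨j, hj, by omega⟩

lemma empProb_shift (n : ℕ) (x : ℤ → A) (a : A) (v : List A) :
    empProb n (shift n x) a v =
      ((occurrences n x (v ++ [a])).card : ℝ) / ((visits n x v).card : ℝ) := by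
  rw [empProb]
  congr 2
  · refine card_eq_of_translate (1 + n) (fun t ht => ?_) fun j hj => ?_
    · simp only [Finset.mem_filter, Finset.mem_Icc, block_shift] at ht
      obtain ⟨⟨h1, h2⟩, h3⟩ := ht
      obtain ⟨j, hj⟩ := Int.eq_ofNat_of_zero_le (a := t + (1 + n)) (by omega)
      refine ⟨j, ?_, hj.symm⟩
      rw [mem_occurrences, suffix_initialWord_succ_iff, List.length_append, List.length_singleton]
      refine ⟨by omega, by omega, ?_⟩
      rw [← hj, ← add_assoc]; exact h3
    · rw [mem_occurrences, suffix_initialWord_succ_iff, List.length_append,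
        List.length_singleton] at hj
      obtain ⟨h1, h2, h3⟩ := hj
      simp only [Finset.mem_filter, Finset.mem_Icc, block_shift]
      refine ⟨⟨by omega, by omega⟩, ?_⟩
      rw [show (j : ℤ) - (1 + n) + 1 + n = j by ring]; exact h3
  · refine card_eq_of_translate (1 + n) (fun t ht => ?_) fun j hj => ?_
    · simp only [Finset.mem_filter, Finset.mem_Icc, block_shift] at ht
      obtain ⟨⟨h1, h2⟩, h3⟩ := ht
      obtain ⟨j, hj⟩ := Int.eq_ofNat_of_zero_le (a := t + (1 + n)) (by omega)
      refine ⟨j, ?_, hj.symm⟩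
      rw [mem_visits, suffix_initialWord_iff]
      refine ⟨by omega, by omega, ?_⟩
      rw [show (j : ℤ) - 1 = t + n by omega]; exact h3
    · rw [mem_visits, suffix_initialWord_iff] at hj
      obtain ⟨h1, h2, h3⟩ := hj
      simp only [Finset.mem_filter, Finset.mem_Icc, block_shift]
      refine ⟨⟨by omega, by omega⟩, ?_⟩
      rw [show (j : ℤ) - (1 + n) + n = j - 1 by ring]; exact h3

/-- Nonemptiness matters: for the empty word the window in `IsFrequent` has n+2 positions, while
`occurrences` has n+1 elements. The test only asks about words `z ++ w ++ [a]`, so nothing is lost.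
-/
lemma isFrequent_shift {γ : ℝ} {n : ℕ} {x : ℤ → A} {u : List A} (hu : u ≠ []) :
    IsFrequent γ n (shift n x) u ↔ (n : ℝ) ^ (1 - γ) < ((occurrences n x u).card : ℝ) := by
  have hl : 1 ≤ u.length := List.length_pos_iff.2 hu
  rw [IsFrequent, card_eq_of_translate (O := occurrences n x u) n (fun t ht => ?_) fun j hj => ?_]
  · simp only [Finset.mem_filter, Finset.mem_Icc, block_shift] at ht
    obtain ⟨⟨h1, h2⟩, h3⟩ := ht
    obtain ⟨j, hj⟩ := Int.eq_ofNat_of_zero_le (a := t + n) (by omega)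
    refine ⟨j, ?_, hj.symm⟩
    rw [mem_occurrences, suffix_initialWord_succ_iff]
    refine ⟨by omega, by omega, ?_⟩
    rw [← hj]; exact h3
  · rw [mem_occurrences, suffix_initialWord_succ_iff] at hj
    obtain ⟨h1, h2, h3⟩ := hj
    simp only [Finset.mem_filter, Finset.mem_Icc, block_shift]
    refine ⟨⟨by omega, by omega⟩, ?_⟩
    rw [show (j : ℤ) - n + n = j by ring]; exact h3

open scoped Classical in
lemma sum_selected_eq {C : ℕ → (ℤ → A) → Prop} {x : ℤ → A} {n : ℕ} {s : Finset ℕ}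
    (hs : ∀ j, j ∈ s ↔ j < n ∧ C j x) :
    ∑ j ∈ Finset.range n, selected C j x = (s.card : ℝ) := by
  have : s = (Finset.range n).filter fun j => C j x := by
    ext j; simp [hs]
  rw [this, Finset.card_filter]
  push_cast
  rfl

open scoped Classical in
lemma sum_deviation_eq {q : A → ℝ} {C : ℕ → (ℤ → A) → Prop} {a : ℕ → (ℤ → A) → A} {x : ℤ → A}
    {n : ℕ} {b : A} {s t : Finset ℕ} (hab : ∀ j, a j x = b) (hs : ∀ j, j ∈ s ↔ j < n ∧ C j x)
    (ht : ∀ j, j ∈ t ↔ j ∈ s ∧ x j = b) :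
    ∑ j ∈ Finset.range n, deviation q C a j x = (t.card : ℝ) - q b * (s.card : ℝ) := by
  have hs' : s = (Finset.range n).filter fun j => C j x := by
    ext j; simp [hs]
  have ht' : t = s.filter fun j : ℕ => x j = b := by
    ext j; simp [ht]
  simp only [deviation, hab]
  rw [← Finset.sum_filter, ← hs', Finset.sum_sub_distrib, ht', Finset.card_filter]
  push_cast
  simp [mul_comm]

end Counts

/-! ### Memory words pass the test -/

section MemoryWords

variable {A : Type*}

/-- Time `j` is at or after `i + e`, and the `l` letters before time `i` end in `w` and occur
again just before time `j`. -/
def Recurs (w : List A) (e i l j : ℕ) (x : ℤ → A) : Prop :=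
  i + e ≤ j ∧ l ≤ i ∧ w <:+ block x ((i : ℤ) - 1) l ∧ block x ((i : ℤ) - 1) l <:+ initialWord x j

lemma block_eq_of_initialWord_eq {x y : ℤ → A} {i l j : ℕ} (hl : l ≤ i) (hij : i ≤ j)
    (h : initialWord x j = initialWord y j) :
    block x ((i : ℤ) - 1) l = block y ((i : ℤ) - 1) l := by
  have h1 := initialWord_eq_of_le hij h
  obtain ⟨d, rfl⟩ := Nat.exists_eq_add_of_le' hl
  rw [initialWord, initialWord, block_add, block_add] at h1
  exact (List.append_inj h1 (by simp)).2

lemma Recurs.congr {w : List A} {e i l j : ℕ} {x y : ℤ → A} (hx : Recurs w e i l j x)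
    (h : initialWord x j = initialWord y j) : Recurs w e i l j y := by
  obtain ⟨h1, h2, h3, h4⟩ := hx
  have hb := block_eq_of_initialWord_eq h2 (by omega) h
  exact ⟨h1, h2, hb ▸ h3, by rw [← hb, ← h]; exact h4⟩

lemma Recurs.suffix {w : List A} {e i l j : ℕ} {x : ℤ → A} (hx : Recurs w e i l j x) :
    w <:+ initialWord x j := hx.2.2.1.trans hx.2.2.2

/-- Starting strictly after time i makes the letter x_i part of the past at every selected time;
this is why the parameter `e` is 1 here and may be 0 when the letter is fixed in advance. -/
lemma isPredictable_recurs_letter (w : List A) (i l : ℕ) :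
    IsPredictable (Recurs w 1 i l) fun _ x => x i := fun _ _ _ h hx =>
  ⟨hx.congr h, eq_of_initialWord_eq (by have := hx.1; omega) h⟩

lemma isPredictable_recurs_const (w : List A) (i l : ℕ) (a : A) :
    IsPredictable (Recurs w 0 i l) fun _ _ => a := fun _ _ _ h hx => ⟨hx.congr h, rfl⟩

/-- The letter at time `i` is overrepresented after the recurrences of the preceding `l`
letters. -/
def upperBad (q : A → ℝ) (w : List A) (N d : ℝ) (n i l : ℕ) : Set (ℤ → A) :=
  {x | N ≤ ∑ j ∈ Finset.range (n + 1), selected (Recurs w 1 i l) j x ∧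
    d * ∑ j ∈ Finset.range (n + 1), selected (Recurs w 1 i l) j x ≤
      1 * ∑ j ∈ Finset.range (n + 1), deviation q (Recurs w 1 i l) (fun _ x => x i) j x}

/-- The letter `a` is underrepresented after the recurrences of the `l` letters before time
`i`. -/
def lowerBad (q : A → ℝ) (w : List A) (N d : ℝ) (n i l : ℕ) (a : A) : Set (ℤ → A) :=
  {x | N ≤ ∑ j ∈ Finset.range (n + 1), selected (Recurs w 0 i l) j x ∧
    d * ∑ j ∈ Finset.range (n + 1), selected (Recurs w 0 i l) j x ≤
      (-1) * ∑ j ∈ Finset.range (n + 1), deviation q (Recurs w 0 i l) (fun _ _ => a) j x}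

/-- Some word ending in `w` that occurs often has a deviating empirical conditional
distribution. -/
def bad (q : A → ℝ) (w : List A) (N d : ℝ) (n : ℕ) : Set (ℤ → A) :=
  ⋃ i ∈ Finset.range (n + 1), ⋃ l ∈ Finset.range (n + 1),
    (upperBad q w N d n i l ∪ ⋃ a, lowerBad q w N d n i l a)

open scoped Classical in
lemma lt_add_of_notMem_bad {q : A → ℝ} {w v : List A} {N d : ℝ} {n : ℕ} {x : ℤ → A} {a : A}
    (hx : x ∉ bad q w N d n) (hwv : w <:+ v) (hd : 0 ≤ d) (hq : 0 ≤ q a)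
    (hN : N + 1 ≤ ((occurrences n x (v ++ [a])).card : ℝ)) (hN0 : 0 ≤ N) :
    ((occurrences n x (v ++ [a])).card : ℝ) < 1 + (q a + d) * ((visits n x v).card : ℝ) := by
  set O := occurrences n x (v ++ [a]) with hO
  have hne : O.Nonempty := by
    rw [← Finset.card_pos]
    have : (0 : ℝ) < O.card := by linarith
    exact_mod_cast this
  -- The first occurrence of `a` after `v` supplies the letter and the place. No earlier visit is
  -- followed by `a`, so passing to the visits after i loses exactly one occurrence, whence the 1 in
  -- the bound.
  set i := O.min' hne with hi
  have hiO : i ∈ O := O.min'_mem hne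
  obtain ⟨hiv, hia⟩ := mem_occurrences_append_singleton.1 hiO
  obtain ⟨hin, hvi⟩ := mem_visits.1 hiv
  obtain ⟨hli, hvb⟩ := suffix_initialWord_iff.1 hvi
  set s := (visits n x v).filter fun j => i < j with hs
  have hxu : x ∉ upperBad q w N d n i v.length := fun h => hx (by
    simp only [bad, Set.mem_iUnion]
    exact ⟨i, Finset.mem_range.2 (by omega), v.length, Finset.mem_range.2 (by omega), Or.inl h⟩)
  have hsC : ∀ j, j ∈ s ↔ j < n + 1 ∧ Recurs w 1 i v.length j x := by
    intro j
    rw [hs, Finset.mem_filter, mem_visits, Recurs, hvb]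
    constructor
    · rintro ⟨⟨h1, h2⟩, h3⟩
      exact ⟨by omega, by omega, hli, hwv, h2⟩
    · rintro ⟨h1, h2, -, -, h3⟩
      exact ⟨⟨by omega, h3⟩, by omega⟩
  have ht : ∀ j, j ∈ O.erase i ↔ j ∈ s ∧ x j = a := by
    intro j
    rw [Finset.mem_erase, hO, mem_occurrences_append_singleton, hs, Finset.mem_filter]
    constructor
    · rintro ⟨h1, h2, h3⟩
      refine ⟨⟨h2, lt_of_le_of_ne (O.min'_le j ?_) (Ne.symm h1)⟩, h3⟩
      exact mem_occurrences_append_singleton.2 ⟨h2, h3⟩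
    · rintro ⟨⟨h1, h2⟩, h3⟩
      exact ⟨by omega, h1, h3⟩
  have hcard : ((O.erase i).card : ℝ) = O.card - 1 := by
    have := Finset.card_erase_add_one hiO
    have h2 : ((O.erase i).card : ℝ) + 1 = O.card := by exact_mod_cast this
    linarith
  have hle : ((O.erase i).card : ℝ) ≤ s.card := by
    exact_mod_cast Finset.card_le_card fun j hj => ((ht j).1 hj).1
  have hsv : (s.card : ℝ) ≤ (visits n x v).card := by
    exact_mod_cast Finset.card_le_card (Finset.filter_subset _ _)
  rw [upperBad, Set.mem_ofPred_eq, sum_selected_eq hsC,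
    sum_deviation_eq (a := fun _ x => x i) (fun _ => hia) hsC ht, not_and, not_le] at hxu
  have h1 := hxu (by linarith)
  have h2 : (q a + d) * (s.card : ℝ) ≤ (q a + d) * ((visits n x v).card : ℝ) :=
    mul_le_mul_of_nonneg_left hsv (by linarith)
  linarith

lemma sub_lt_of_notMem_bad {q : A → ℝ} {w v : List A} {N d : ℝ} {n : ℕ} {x : ℤ → A} {a : A}
    (hx : x ∉ bad q w N d n) (hwv : w <:+ v)
    (hN : N + 1 ≤ ((visits n x v).card : ℝ)) (hN0 : 0 ≤ N) :
    (q a - d) * ((visits n x v).card : ℝ) < ((occurrences n x (v ++ [a])).card : ℝ) := by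
  set V := visits n x v with hV
  have hne : V.Nonempty := by
    rw [← Finset.card_pos]
    have : (0 : ℝ) < V.card := by linarith
    exact_mod_cast this
  -- With the place taken at the first visit, the recurrences from time i on are all the visits.
  set i := V.min' hne with hi
  have hiV : i ∈ V := V.min'_mem hne
  obtain ⟨hin, hvi⟩ := mem_visits.1 hiV
  obtain ⟨hli, hvb⟩ := suffix_initialWord_iff.1 hvi
  have hxl : x ∉ lowerBad q w N d n i v.length a := fun h => hx (by
    simp only [bad, Set.mem_iUnion]
    exact ⟨i, Finset.mem_range.2 (by omega), v.length, Finset.mem_range.2 (by omega),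
      Or.inr (Set.mem_iUnion.2 ⟨a, h⟩)⟩)
  have hsC : ∀ j, j ∈ V ↔ j < n + 1 ∧ Recurs w 0 i v.length j x := by
    intro j
    rw [Recurs, hvb]
    constructor
    · intro hj
      obtain ⟨h1, h2⟩ := mem_visits.1 hj
      exact ⟨by omega, V.min'_le j hj, hli, hwv, h2⟩
    · rintro ⟨h1, h2, -, -, h3⟩
      exact mem_visits.2 ⟨by omega, h3⟩
  rw [lowerBad, Set.mem_ofPred_eq, sum_selected_eq hsC,
    sum_deviation_eq (a := fun _ _ => a) (fun _ => rfl) hsC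
      (fun j => mem_occurrences_append_singleton), not_and, not_le] at hxl
  have h1 := hxl (by linarith)
  linarith

/-- The additive 1 in the upper estimate is absorbed into d times the number of visits by `hNd`,
which accounts for 2d in place of d. -/
lemma abs_empProb_sub_le {q : A → ℝ} {w v : List A} {N d : ℝ} {n : ℕ} {x : ℤ → A} {a : A}
    (hx : x ∉ bad q w N d n) (hwv : w <:+ v) (hd : 0 ≤ d) (hq : 0 ≤ q a)
    (hN : N + 1 ≤ ((occurrences n x (v ++ [a])).card : ℝ)) (hN0 : 0 ≤ N)
    (hNd : 1 ≤ d * (N + 1)) :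
    |empProb n (shift n x) a v - q a| ≤ 2 * d := by
  have hOV : ((occurrences n x (v ++ [a])).card : ℝ) ≤ (visits n x v).card := by
    exact_mod_cast Finset.card_le_card occurrences_append_singleton_subset
  have h1 := lt_add_of_notMem_bad hx hwv hd hq hN hN0
  have h2 := sub_lt_of_notMem_bad (a := a) hx hwv (hN.trans hOV) hN0
  have hpos : (0 : ℝ) < (visits n x v).card := by linarith
  have h3 : 1 ≤ d * ((visits n x v).card : ℝ) :=
    hNd.trans (mul_le_mul_of_nonneg_left (hN.trans hOV) hd)
  rw [empProb_shift, abs_le]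
  constructor
  · rw [le_sub_iff_add_le, le_div_iff₀ hpos]
    nlinarith
  · rw [sub_le_iff_le_add, div_le_iff₀ hpos]
    nlinarith

/-- If `zwa` is frequent, so is its suffix `wa`. Both empirical probabilities are then within 2d =
n^{-β}/2 of the same q(a), and the triangle inequality gives exactly the threshold n^{-β}. -/
lemma ptest_of_notMem_bad {q : A → ℝ} {w : List A} {γ β : ℝ} {n : ℕ} {x : ℤ → A}
    (hn : 1 ≤ n) (hγ : γ < 1) (hq : ∀ a, 0 ≤ q a)
    (hx : x ∉ bad q w ((n : ℝ) ^ (1 - γ) - 1) ((n : ℝ) ^ (-β) / 4) n)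
    (hN : 1 ≤ (n : ℝ) ^ (-β) / 4 * (n : ℝ) ^ (1 - γ)) : PTest γ β n x w := by
  have hd : 0 ≤ (n : ℝ) ^ (-β) / 4 := by positivity
  have hN0 : 0 ≤ (n : ℝ) ^ (1 - γ) - 1 :=
    sub_nonneg.2 (Real.one_le_rpow (by exact_mod_cast hn) (by linarith))
  refine Real.sSup_le ?_ (by positivity)
  rintro r ⟨z, a, -, -, hf, rfl⟩
  rw [isFrequent_shift (by simp)] at hf
  have hsub : ((occurrences n x (z ++ w ++ [a])).card : ℝ) ≤ (occurrences n x (w ++ [a])).card := by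
    exact_mod_cast Finset.card_le_card
      (occurrences_subset_of_suffix ⟨z, by rw [List.append_assoc]⟩)
  have h1 := abs_empProb_sub_le (a := a) hx List.suffix_rfl hd (hq a) (by linarith) hN0
    (by simpa using hN)
  have h2 := abs_empProb_sub_le (v := z ++ w) (a := a) hx (List.suffix_append _ _) hd (hq a)
    (by linarith) hN0 (by simpa using hN)
  rw [abs_le] at h1 h2 ⊢
  constructor <;> linarith

variable [MeasurableSpace A] [Countable A] [DiscreteMeasurableSpace A]
  {ν : Measure (ℤ → A)} [IsProbabilityMeasure ν]

lemma measure_upperBad_le (hT : MeasurePreserving (shift 1) ν ν) {w : List A}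
    (hw : IsMemoryWord ν w) (hpos : 0 < lawProb ν w) {N d : ℝ} (hd0 : 0 ≤ d) (hd1 : d ≤ 1)
    (n i l : ℕ) :
    ν (upperBad (transProb ν w) w N d n i l) ≤ ENNReal.ofReal (Real.exp (-(N * d ^ 2 / 4))) :=
  measure_deviation_le hT hw hpos (isPredictable_recurs_letter w i l) (fun _ _ h => h.suffix)
    (by simp) hd0 hd1 (n + 1)

/-- The factor q(a)/d makes the bound summable over an infinite alphabet. When q(a) ≥ d it only
weakens the exponential bound; when q(a) < d the event is empty, as a frequency cannot fall short of
q(a) by more than q(a). -/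
lemma measure_lowerBad_le (hT : MeasurePreserving (shift 1) ν ν) {w : List A}
    (hw : IsMemoryWord ν w) (hpos : 0 < lawProb ν w) {N d : ℝ} (hN : 0 < N) (hd0 : 0 < d)
    (hd1 : d ≤ 1) (n i l : ℕ) (a : A) :
    ν (lowerBad (transProb ν w) w N d n i l a) ≤
      ENNReal.ofReal (transProb ν w a / d * Real.exp (-(N * d ^ 2 / 4))) := by
  by_cases hq : d ≤ transProb ν w a
  · refine (measure_deviation_le hT hw hpos (isPredictable_recurs_const w i l a)
      (fun _ _ h => h.suffix) (by simp) hd0.le hd1 (n + 1)).trans (ENNReal.ofReal_le_ofReal ?_)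
    exact le_mul_of_one_le_left (Real.exp_pos _).le ((one_le_div hd0).2 hq)
  · have : lowerBad (transProb ν w) w N d n i l a = ∅ := by
      rw [Set.eq_empty_iff_forall_notMem]
      rintro x ⟨h1, h2⟩
      have h3 : (-1) * ∑ j ∈ Finset.range (n + 1),
          deviation (transProb ν w) (Recurs w 0 i l) (fun _ _ => a) j x ≤
          transProb ν w a * ∑ j ∈ Finset.range (n + 1), selected (Recurs w 0 i l) j x := by
        rw [Finset.mul_sum, Finset.mul_sum]
        refine Finset.sum_le_sum fun j _ => ?_
        by_cases hC : Recurs w 0 i l j x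
        · simp only [deviation, selected, if_pos hC]
          split_ifs <;> linarith
        · simp [deviation, selected, hC]
      have h4 := mul_lt_mul_of_pos_right (not_le.1 hq) (hN.trans_le h1)
      linarith
    rw [this]
    simp

/-- A union bound over (n+1)² places; at each place the overrepresentation event counts once, and
the underrepresentation events together contribute 1/d because the q(a) sum to 1. -/
lemma measure_bad_le (hT : MeasurePreserving (shift 1) ν ν) {w : List A}
    (hw : IsMemoryWord ν w) (hpos : 0 < lawProb ν w) {N d : ℝ} (hN : 0 < N) (hd0 : 0 < d)
    (hd1 : d ≤ 1) (n : ℕ) :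
    ν (bad (transProb ν w) w N d n) ≤
      ENNReal.ofReal (((n : ℝ) + 1) ^ 2 * ((1 + 1 / d) * Real.exp (-(N * d ^ 2 / 4)))) := by
  set E := Real.exp (-(N * d ^ 2 / 4)) with hE
  have hE0 : 0 < E := Real.exp_pos _
  have h1 : ∀ i l, ν (upperBad (transProb ν w) w N d n i l ∪
      ⋃ a, lowerBad (transProb ν w) w N d n i l a) ≤ ENNReal.ofReal ((1 + 1 / d) * E) := by
    intro i l
    have hsum : HasSum (fun a => transProb ν w a / d * E) (1 / d * E) :=
      ((hasSum_transProb hT hpos).div_const d).mul_right E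
    rw [add_mul, one_mul, ENNReal.ofReal_add hE0.le (by positivity)]
    refine (measure_union_le _ _).trans
      (add_le_add (measure_upperBad_le hT hw hpos hd0.le hd1 n i l) ?_)
    refine (measure_iUnion_le _).trans ((ENNReal.tsum_le_tsum fun a =>
      measure_lowerBad_le hT hw hpos hN hd0 hd1 n i l a).trans (le_of_eq ?_))
    rw [← hsum.tsum_eq, ENNReal.ofReal_tsum_of_nonneg _ hsum.summable]
    exact fun a => mul_nonneg (div_nonneg (transProb_nonneg _ _) hd0.le) hE0.le
  calc ν (bad (transProb ν w) w N d n)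
      ≤ ∑ i ∈ Finset.range (n + 1), ∑ l ∈ Finset.range (n + 1),
          ENNReal.ofReal ((1 + 1 / d) * E) := by
        refine (measure_biUnion_finset_le _ _).trans (Finset.sum_le_sum fun i _ => ?_)
        exact (measure_biUnion_finset_le _ _).trans (Finset.sum_le_sum fun l _ => h1 i l)
    _ = _ := by
        simp only [Finset.sum_const, Finset.card_range, nsmul_eq_mul]
        rw [← mul_assoc, ENNReal.ofReal_mul (p := ((n : ℝ) + 1) ^ 2) (by positivity), ← sq,
          ENNReal.ofReal_pow (by positivity), ← Nat.cast_succ, ENNReal.ofReal_natCast]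

lemma summable_bad_bound {γ β : ℝ} (hβ0 : 0 < β) (hβ1 : β < (1 - γ) / 2)
    (hγ0 : 0 < γ) :
    Summable fun n : ℕ => ((n : ℝ) + 1) ^ 2 * ((1 + 1 / ((n : ℝ) ^ (-β) / 4)) *
      Real.exp (-(((n : ℝ) ^ (1 - γ) - 1) * ((n : ℝ) ^ (-β) / 4) ^ 2 / 4))) := by
  set α := 1 - γ - 2 * β with hα
  have hα0 : 0 < α := by linarith
  have hlim : Tendsto (fun n : ℕ => (n : ℝ) ^ α) atTop atTop :=
    (tendsto_rpow_atTop hα0).comp tendsto_natCast_atTop_atTop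
  -- The exponent is Nd²/4 = (n^{1-γ} - 1) n^{-2β}/64 ≥ (n^α - 1)/64. The power -5/α turns the decay
  -- into n^{-5}, which beats the prefactor of order n³ and leaves n^{-2}.
  have ho := ((isLittleO_exp_neg_mul_rpow_atTop (a := 1 / 64) (by norm_num)
    (-5 / α)).comp_tendsto hlim).bound one_pos
  refine summable_of_isBigO_nat (g := fun n : ℕ => 1 / (n : ℝ) ^ 2)
    (Real.summable_one_div_nat_pow.2 one_lt_two) ?_
  refine Asymptotics.IsBigO.of_bound (20 * Real.exp (1 / 64)) ?_
  filter_upwards [ho, eventually_ge_atTop 1] with n hn hn1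
  have hn1' : (1 : ℝ) ≤ n := by exact_mod_cast hn1
  have hn0 : (0 : ℝ) < n := by linarith
  simp only [Function.comp, one_mul, Real.norm_eq_abs, Real.abs_exp] at hn
  rw [← Real.rpow_mul hn0.le, mul_div_cancel₀ _ hα0.ne', abs_of_nonneg (by positivity)] at hn
  have e5 : (n : ℝ) ^ (-5 : ℝ) = 1 / (n : ℝ) ^ 5 := by
    rw [Real.rpow_neg hn0.le, one_div]; norm_num
  rw [e5] at hn
  rw [Real.norm_of_nonneg (by positivity), Real.norm_of_nonneg (by positivity)]
  have hexp : Real.exp (-(((n : ℝ) ^ (1 - γ) - 1) * ((n : ℝ) ^ (-β) / 4) ^ 2 / 4)) ≤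
      Real.exp (1 / 64) * (1 / (n : ℝ) ^ 5) := by
    refine le_trans ?_ (mul_le_mul_of_nonneg_left hn (Real.exp_pos _).le)
    rw [← Real.exp_add]
    refine Real.exp_le_exp.2 ?_
    have e1 : (n : ℝ) ^ α = (n : ℝ) ^ (1 - γ) * ((n : ℝ) ^ (-β)) ^ 2 := by
      rw [← Real.rpow_natCast, ← Real.rpow_mul hn0.le, ← Real.rpow_add hn0]
      congr 1; push_cast; rw [hα]; ring
    have e2 : ((n : ℝ) ^ (-β)) ^ 2 ≤ 1 :=
      pow_le_one₀ (by positivity) (Real.rpow_le_one_of_one_le_of_nonpos hn1' (by linarith))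
    rw [e1]
    nlinarith
  have hd : 1 / ((n : ℝ) ^ (-β) / 4) ≤ 4 * n := by
    rw [Real.rpow_neg hn0.le, one_div_div, div_inv_eq_mul]
    refine mul_le_mul_of_nonneg_left ?_ (by norm_num)
    calc (n : ℝ) ^ β ≤ (n : ℝ) ^ (1 : ℝ) := Real.rpow_le_rpow_of_exponent_le hn1' (by linarith)
      _ = n := Real.rpow_one _
  calc ((n : ℝ) + 1) ^ 2 * ((1 + 1 / ((n : ℝ) ^ (-β) / 4)) *
      Real.exp (-(((n : ℝ) ^ (1 - γ) - 1) * ((n : ℝ) ^ (-β) / 4) ^ 2 / 4)))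
      ≤ (2 * n) ^ 2 * ((5 * n) * (Real.exp (1 / 64) * (1 / (n : ℝ) ^ 5))) := by
        gcongr <;> linarith
    _ = 20 * Real.exp (1 / 64) * (1 / (n : ℝ) ^ 2) := by
        field_simp
        ring

/-- Memory words of positive probability pass the test from some time on. -/
theorem IsMemoryWord.ae_eventually_ptest (hT : MeasurePreserving (shift 1) ν ν) {w : List A}
    (hw : IsMemoryWord ν w) (hpos : 0 < lawProb ν w) {γ β : ℝ} (hγ0 : 0 < γ) (hγ1 : γ < 1)
    (hβ0 : 0 < β) (hβ1 : β < (1 - γ) / 2) :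
    ∀ᵐ x ∂ν, ∀ᶠ n : ℕ in atTop, PTest γ β n x w := by
  have hsum := summable_bad_bound hβ0 hβ1 hγ0
  -- For n < 2 the count N = n^{1-γ} - 1 is not positive, so the bound on the bad set is
  -- unavailable; these finitely many times are discarded.
  set B : ℕ → Set (ℤ → A) := fun n =>
    if 2 ≤ n then bad (transProb ν w) w ((n : ℝ) ^ (1 - γ) - 1) ((n : ℝ) ^ (-β) / 4) n else ∅
    with hB
  have hBle : ∀ n, ν (B n) ≤ ENNReal.ofReal (((n : ℝ) + 1) ^ 2 *
      ((1 + 1 / ((n : ℝ) ^ (-β) / 4)) *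
        Real.exp (-(((n : ℝ) ^ (1 - γ) - 1) * ((n : ℝ) ^ (-β) / 4) ^ 2 / 4)))) := by
    intro n
    by_cases hn : 2 ≤ n
    · simp only [hB, if_pos hn]
      have hn1 : (1 : ℝ) < n := by exact_mod_cast hn
      refine measure_bad_le hT hw hpos ?_ (by positivity) ?_ n
      · exact sub_pos.2 (Real.one_lt_rpow hn1 (by linarith))
      · linarith [Real.rpow_le_one_of_one_le_of_nonpos hn1.le (by linarith : -β ≤ 0)]
    · simp [hB, if_neg hn]
  have hBC := ae_eventually_notMem (μ := ν) (s := B)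
    (ne_top_of_le_ne_top hsum.tsum_ofReal_ne_top (ENNReal.tsum_le_tsum hBle))
  have hlim : Tendsto (fun n : ℕ => (n : ℝ) ^ (1 - γ - β)) atTop atTop :=
    (tendsto_rpow_atTop (by linarith)).comp tendsto_natCast_atTop_atTop
  filter_upwards [hBC] with x hx
  filter_upwards [hx, eventually_ge_atTop 2, hlim.eventually_ge_atTop 4] with n hn hn2 hn4
  simp only [hB, if_pos hn2] at hn
  refine ptest_of_notMem_bad (by omega) hγ1 (fun a => transProb_nonneg w a) hn ?_
  have hn0 : (0 : ℝ) < n := by exact_mod_cast (by omega : 0 < n)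
  rw [div_mul_eq_mul_div, ← Real.rpow_add hn0, le_div_iff₀ (by norm_num)]
  rw [show -β + (1 - γ) = 1 - γ - β by ring]
  linarith

end MemoryWords

/-! ### Words that are not memory words fail the test -/

section OtherWords

variable {A : Type*}

lemma empProb_shift_mem_Icc (n : ℕ) (x : ℤ → A) (a : A) (v : List A) :
    empProb n (shift n x) a v ∈ Set.Icc (0 : ℝ) 1 := by
  rw [empProb_shift]
  refine ⟨by positivity, div_le_one_of_le₀ ?_ (Nat.cast_nonneg _)⟩
  exact_mod_cast Finset.card_le_card occurrences_append_singleton_subset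

lemma not_ptest_of_lt {γ β : ℝ} {n : ℕ} {x : ℤ → A} {z w : List A} {a : A} (hz : 1 ≤ z.length)
    (hzn : z.length ≤ n)
    (hf : (n : ℝ) ^ (1 - γ) < ((occurrences n x (z ++ w ++ [a])).card : ℝ))
    (hlt : (n : ℝ) ^ (-β) <
      |empProb n (shift n x) a w - empProb n (shift n x) a (z ++ w)|) : ¬ PTest γ β n x w := by
  -- The supremum dominates the witness only because the set is bounded: empirical probabilities lie
  -- in [0, 1], including the value 0 of an empty quotient.
  refine not_le.2 (hlt.trans_le (le_csSup ⟨1, ?_⟩ ⟨z, a, hz, hzn, ?_, rfl⟩))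
  · rintro r ⟨z', b, -, -, -, rfl⟩
    have h1 := empProb_shift_mem_Icc n x b w
    have h2 := empProb_shift_mem_Icc n x b (z' ++ w)
    rw [abs_le]
    constructor <;> linarith [h1.1, h1.2, h2.1, h2.2]
  · rwa [isFrequent_shift (by simp)]

/-- A count with positive limiting frequency grows linearly, and n^{1-γ} = n · n^{-γ} is sublinear.
-/
lemma eventually_rpow_lt_of_tendsto {c : ℕ → ℝ} {p γ : ℝ} (hp : 0 < p) (hγ : 0 < γ)
    (hc : Tendsto (fun n : ℕ => c n / ((n : ℝ) + 1)) atTop (𝓝 p)) :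
    ∀ᶠ n : ℕ in atTop, (n : ℝ) ^ (1 - γ) < c n := by
  have h0 : Tendsto (fun n : ℕ => (n : ℝ) ^ (-γ)) atTop (𝓝 0) :=
    (tendsto_rpow_neg_atTop hγ).comp tendsto_natCast_atTop_atTop
  filter_upwards [h0.eventually (gt_mem_nhds (half_pos hp)),
    hc.eventually (lt_mem_nhds (half_lt_self hp)), eventually_gt_atTop 0] with n h1 h2 hn
  have hn0 : (0 : ℝ) < n := by exact_mod_cast hn
  rw [lt_div_iff₀ (by positivity)] at h2
  have e : (n : ℝ) ^ (1 - γ) = (n : ℝ) ^ (-γ) * n := by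
    rw [← Real.rpow_add_one hn0.ne']; congr 1; ring
  rw [e]
  nlinarith

variable [MeasurableSpace A] [Countable A] [DiscreteMeasurableSpace A]
  {ν : Measure (ℤ → A)} [IsProbabilityMeasure ν]

lemma ae_tendsto_card_occurrences (hT : Ergodic (shift 1) ν) :
    ∀ᵐ x ∂ν, ∀ u : List A, Tendsto
      (fun n : ℕ => ((occurrences n x u).card : ℝ) / ((n : ℝ) + 1)) atTop (𝓝 (lawProb ν u)) := by
  refine ae_all_iff.2 fun u => ?_
  filter_upwards [ae_tendsto_frequency hT (measurableSet_cylinder 0 u)] with x hx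
  have h := (hx (fun j => u <:+ initialWord x (j + 1)) u.length fun m hm => by
    rw [suffix_initialWord_succ_iff, cylinder, Set.mem_ofPred_eq, block_shift, zero_add]
    exact ⟨fun h => h.2, fun h => ⟨by omega, h⟩⟩).comp (tendsto_add_atTop_nat 1)
  refine h.congr fun n => ?_
  simp only [Function.comp, Nat.cast_add, Nat.cast_one]
  congr 3
  ext j
  simp only [mem_occurrences, Finset.mem_filter, Finset.mem_range, Nat.lt_succ_iff]

lemma ae_tendsto_card_visits (hT : Ergodic (shift 1) ν) :
    ∀ᵐ x ∂ν, ∀ v : List A, Tendsto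
      (fun n : ℕ => ((visits n x v).card : ℝ) / ((n : ℝ) + 1)) atTop (𝓝 (lawProb ν v)) := by
  refine ae_all_iff.2 fun v => ?_
  filter_upwards [ae_tendsto_frequency hT (measurableSet_cylinder (-1) v)] with x hx
  rw [measureReal_cylinder hT.toMeasurePreserving] at hx
  have h := (hx (fun j => v <:+ initialWord x j) v.length fun m hm => by
    rw [suffix_initialWord_iff, cylinder, Set.mem_ofPred_eq, block_shift, neg_add_eq_sub]
    exact ⟨fun h => h.2, fun h => ⟨by omega, h⟩⟩).comp (tendsto_add_atTop_nat 1)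
  refine h.congr fun n => ?_
  simp only [Function.comp, Nat.cast_add, Nat.cast_one]
  congr 3
  ext j
  simp only [mem_visits, Finset.mem_filter, Finset.mem_range, Nat.lt_succ_iff]

lemma ae_tendsto_empProb (hT : Ergodic (shift 1) ν) :
    ∀ᵐ x ∂ν, ∀ (v : List A) (a : A), 0 < lawProb ν v →
      Tendsto (fun n : ℕ => empProb n (shift n x) a v) atTop (𝓝 (transProb ν v a)) := by
  filter_upwards [ae_tendsto_card_occurrences hT, ae_tendsto_card_visits hT] with x hx hy v a hv
  refine ((hx (v ++ [a])).div (hy v) hv.ne').congr fun n => ?_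
  rw [empProb_shift]
  exact div_div_div_cancel_right₀ (by positivity) _ _

/-- Words of positive probability that are not memory words fail the test from some time on. -/
theorem ae_eventually_not_ptest (hT : Ergodic (shift 1) ν) {γ β : ℝ} (hγ : 0 < γ) (hβ : 0 < β) :
    ∀ᵐ x ∂ν, ∀ w : List A, 0 < lawProb ν w → ¬ IsMemoryWord ν w →
      ∀ᶠ n : ℕ in atTop, ¬ PTest γ β n x w := by
  filter_upwards [ae_tendsto_card_occurrences hT, ae_tendsto_empProb hT] with x hx hy w hpos hw
  simp only [IsMemoryWord, not_forall] at hw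
  obtain ⟨z, a, hz, hza, hne⟩ := hw
  have hzw : 0 < lawProb ν (z ++ w) := hza.trans_le
    (le_hasSum (hasSum_lawProb_append hT.toMeasurePreserving (z ++ w)) a
      fun _ _ => lawProb_nonneg _)
  have hlim := ((hy w a hpos).sub (hy (z ++ w) a hzw)).abs
  have h0 : Tendsto (fun n : ℕ => (n : ℝ) ^ (-β)) atTop (𝓝 0) :=
    (tendsto_rpow_neg_atTop hβ).comp tendsto_natCast_atTop_atTop
  filter_upwards [h0.eventually_lt hlim (abs_pos.2 (sub_ne_zero.2 hne)),
    eventually_ge_atTop z.length, eventually_rpow_lt_of_tendsto hza hγ (hx _)] with n h1 h2 h3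
  exact not_ptest_of_lt hz h2 h3 h1

lemma ae_not_suffix_of_lawProb_eq_zero (hT : MeasurePreserving (shift 1) ν ν) :
    ∀ᵐ x ∂ν, ∀ u : List A, lawProb ν u = 0 → ∀ j : ℕ, ¬ u <:+ initialWord x j := by
  refine ae_all_iff.2 fun u => ?_
  by_cases hu : lawProb ν u = 0
  · have h : ∀ j : ℕ, ∀ᵐ x ∂ν, x ∉ cylinder ((j : ℤ) - 1) u := fun j => by
      rw [← measure_eq_zero_iff_ae_notMem]
      rwa [← measureReal_cylinder hT ((j : ℤ) - 1), measureReal_eq_zero_iff] at hu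
    filter_upwards [ae_all_iff.2 h] with x hx _ j hj
    exact hx j (suffix_initialWord_iff.1 hj).2
  · exact Eventually.of_forall fun x h => absurd h hu

/-- Almost surely, the test classifies each word correctly from some time on, as far as the
word occurs. -/
theorem ae_eventually_ptest_iff (hT : Ergodic (shift 1) ν) {γ β : ℝ} (hγ0 : 0 < γ) (hγ1 : γ < 1)
    (hβ0 : 0 < β) (hβ1 : β < (1 - γ) / 2) :
    ∀ᵐ x ∂ν, ∀ u : List A, ∀ᶠ n : ℕ in atTop, ∀ j : ℕ, u <:+ initialWord x j →
      (PTest γ β n x u ↔ IsMemoryWord ν u) := by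
  have hm : ∀ᵐ x ∂ν, ∀ u : List A, 0 < lawProb ν u → IsMemoryWord ν u →
      ∀ᶠ n : ℕ in atTop, PTest γ β n x u := ae_all_iff.2 fun u => by
    by_cases h : 0 < lawProb ν u ∧ IsMemoryWord ν u
    · filter_upwards [h.2.ae_eventually_ptest hT.toMeasurePreserving h.1 hγ0 hγ1 hβ0 hβ1]
        with x hx _ _ using hx
    · exact Eventually.of_forall fun x h1 h2 => absurd ⟨h1, h2⟩ h
  filter_upwards [hm, ae_eventually_not_ptest hT hγ0 hβ0,
    ae_not_suffix_of_lawProb_eq_zero hT.toMeasurePreserving] with x h1 h2 h3 u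
  rcases (lawProb_nonneg (ν := ν) u).eq_or_lt with h0 | h0
  -- A word of probability zero almost surely never occurs, so the claim is vacuous for it.
  · exact Eventually.of_forall fun n j hj => absurd hj (h3 u h0.symm j)
  · by_cases hu : IsMemoryWord ν u
    · filter_upwards [h1 u h0 hu] with n hn j _ using ⟨fun _ => hu, fun _ => hn⟩
    · filter_upwards [h2 u h0 hu] with n hn j _ using ⟨fun h => absurd h hn, fun h => absurd h hu⟩

end OtherWords

/-! ### The estimator on a typical path -/

section Estimator

variable {A : Type*}

/-- One of the memory words among `w(0), …, w(j)` ends at time `m` within `x_0^m`. -/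
def MemoryAt (M : List A → Prop) (w : ℕ → List A) (j m : ℕ) (x : ℤ → A) : Prop :=
  ∃ i ≤ j, M (w i) ∧ w i <:+ initialWord x (m + 1)

lemma MemoryAt.mono {M : List A → Prop} {w : ℕ → List A} {j k m : ℕ} {x : ℤ → A} (hjk : j ≤ k)
    (h : MemoryAt M w j m x) : MemoryAt M w k m x := by
  obtain ⟨i, hi, h⟩ := h
  exact ⟨i, hi.trans hjk, h⟩

variable {γ β ε : ℝ} {w : ℕ → List A} {x : ℤ → A} {M : List A → Prop}

lemma mem_covered {n j m : ℕ} :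
    m ∈ covered γ β w n x j ↔
      m ≤ n ∧ ∃ i ≤ j, PTest γ β n x (w i) ∧ w i <:+ initialWord x (m + 1) := by
  simp only [covered, Finset.mem_biUnion, Finset.mem_filter, Finset.mem_range, mem_occurrences,
    Nat.lt_succ_iff]
  constructor
  · rintro ⟨i, ⟨h1, h2⟩, h3, h4⟩
    exact ⟨h3, i, h1, h2, h4⟩
  · rintro ⟨h3, i, h1, h2, h4⟩
    exact ⟨i, ⟨h1, h2⟩, h3, h4⟩

lemma mem_covered_iff_memoryAt {n j J m : ℕ} (hjJ : j ≤ J)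
    (hset : ∀ i ≤ J, ∀ k : ℕ, w i <:+ initialWord x k → (PTest γ β n x (w i) ↔ M (w i))) :
    m ∈ covered γ β w n x j ↔ m ≤ n ∧ MemoryAt M w j m x := by
  rw [mem_covered]
  refine and_congr_right fun _ => exists_congr fun i => and_congr_right fun hi => ?_
  exact and_congr_left fun h => hset i (hi.trans hjJ) _ h

lemma theta_le {n j : ℕ} (hjn : j < n)
    (h : 1 - ε / 2 ≤ ((covered γ β w n x j).card : ℝ) / ((n : ℝ) + 1)) :
    theta γ β ε w n x ≤ j := Nat.sInf_le (Or.inl ⟨hjn, h⟩)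

lemma theta_spec (γ β ε : ℝ) (w : ℕ → List A) (n : ℕ) (x : ℤ → A) :
    (theta γ β ε w n x < n ∧ 1 - ε / 2 ≤
      ((covered γ β w n x (theta γ β ε w n x)).card : ℝ) / ((n : ℝ) + 1)) ∨
        theta γ β ε w n x = n :=
  Nat.sInf_mem (s := {j : ℕ | (j < n ∧
    1 - ε / 2 ≤ ((covered γ β w n x j).card : ℝ) / ((n : ℝ) + 1)) ∨ j = n}) ⟨n, Or.inr rfl⟩

open scoped Classical in
/-- If finitely many words of the list are classified correctly from some time on, and the memory
words among the first ones have frequencies `P j`, the first large one being `P j₀`, then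
eventually `j₀ ≤ θ_n ≤ J`. -/
lemma eventually_theta_mem_Icc {P : ℕ → ℝ} {j₀ J : ℕ}
    (hset : ∀ u : List A, ∀ᶠ n : ℕ in atTop, ∀ j : ℕ, u <:+ initialWord x j →
      (PTest γ β n x u ↔ M u))
    (hfreq : ∀ j, Tendsto
      (fun n : ℕ => (((Finset.range n).filter fun m => MemoryAt M w j m x).card : ℝ) / n) atTop
      (𝓝 (P j)))
    (hlow : ∀ j < j₀, P j < 1 - ε / 2) (hJ : 1 - ε / 2 < P J) (hj₀J : j₀ ≤ J) :
    ∀ᶠ n : ℕ in atTop, theta γ β ε w n x ∈ Set.Icc j₀ J := by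
  have hset' : ∀ᶠ n : ℕ in atTop, ∀ i ∈ Finset.range (J + 1), ∀ k : ℕ,
      w i <:+ initialWord x k → (PTest γ β n x (w i) ↔ M (w i)) :=
    (Finset.eventually_all _).2 fun i _ => hset (w i)
  have hf : ∀ j, Tendsto (fun n : ℕ =>
      (((Finset.range (n + 1)).filter fun m => MemoryAt M w j m x).card : ℝ) / ((n : ℝ) + 1))
      atTop (𝓝 (P j)) := fun j => by
    simpa [Function.comp_def] using (hfreq j).comp (tendsto_add_atTop_nat 1)
  have hlow' : ∀ᶠ n : ℕ in atTop, ∀ j ∈ Finset.range j₀,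
      (((Finset.range (n + 1)).filter fun m => MemoryAt M w j m x).card : ℝ) / ((n : ℝ) + 1)
        < 1 - ε / 2 :=
    (Finset.eventually_all _).2 fun j hj =>
      (hf j).eventually (gt_mem_nhds (hlow j (Finset.mem_range.1 hj)))
  filter_upwards [hset', hlow', (hf J).eventually (lt_mem_nhds hJ), eventually_gt_atTop J]
    with n h1 h2 h3 h4
  have hcov : ∀ j ≤ J, covered γ β w n x j =
      (Finset.range (n + 1)).filter fun m => MemoryAt M w j m x := by
    intro j hj
    ext m
    rw [mem_covered_iff_memoryAt hj fun i hi => h1 i (Finset.mem_range.2 (by omega)),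
      Finset.mem_filter, Finset.mem_range, Nat.lt_succ_iff]
  refine ⟨?_, theta_le h4 (by rw [hcov J le_rfl]; exact h3.le)⟩
  by_contra hlt
  rw [not_le] at hlt
  -- Below j₀ the coverage is too small for θ_n to stop there, and the default value n exceeds J. At
  -- j₀ itself the limit may equal 1 - ε/2, so θ_n is only confined to an interval and need not
  -- converge.
  rcases theta_spec γ β ε w n x with h | h
  · rw [hcov _ (by omega)] at h
    exact absurd h.2 (not_le.2 (h2 _ (Finset.mem_range.2 hlt)))
  · omega

/-- At the estimation times the selected word is a memory word, no shorter suffix of the past is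
one, and it has a bounded index. -/
lemma kappa_spec (hw : IsWordList w) {n J : ℕ} (hθ : theta γ β ε w n x ≤ J)
    (hset : ∀ i ≤ J, ∀ k : ℕ, w i <:+ initialWord x k → (PTest γ β n x (w i) ↔ M (w i)))
    (hn : n ∈ estTimes γ β ε w x) :
    kappa γ β w n x ≤ J ∧ block x n (rho γ β w n x) = w (kappa γ β w n x) ∧
      M (block x n (rho γ β w n x)) ∧ w (kappa γ β w n x) <:+ initialWord x (n + 1) ∧
      ∀ k, M (block x n k) → rho γ β w n x ≤ k := by
  obtain ⟨-, i, hi, hti, hsi⟩ := mem_covered.1 (show n ∈ covered γ β w n x _ from hn)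
  have hmem : i ∈ {i : ℕ | (w i).length ≤ n + 1 ∧ block x n (w i).length = w i ∧
      PTest γ β n x (w i)} := by
    obtain ⟨h1, h2⟩ := suffix_initialWord_succ_iff.1 hsi
    exact ⟨h1, h2, hti⟩
  have hle : kappa γ β w n x ≤ J := (Nat.sInf_le hmem).trans (hi.trans hθ)
  obtain ⟨h1, h2, h3⟩ : kappa γ β w n x ∈ {i : ℕ | (w i).length ≤ n + 1 ∧
    block x n (w i).length = w i ∧ PTest γ β n x (w i)} := Nat.sInf_mem ⟨i, hmem⟩
  have hsuf := suffix_initialWord_succ_iff.2 ⟨h1, h2⟩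
  have hM := (hset _ hle _ hsuf).1 h3
  refine ⟨hle, h2, by rw [rho, h2]; exact hM, hsuf, fun k hk => ?_⟩
  -- A shorter memory suffix of the past would be a suffix of the selected word, hence listed no
  -- later, and would itself be accepted; minimality of κ_n excludes it.
  by_contra hlt
  rw [not_le] at hlt
  obtain ⟨i', hi'⟩ := hw.bijective.surjective (block x n k)
  have hlen : (w i').length = k := by rw [hi', length_block]
  have hsuf' : w i' <:+ w (kappa γ β w n x) := by
    rw [hi', ← h2, suffix_block_iff, length_block]
    exact ⟨hlt.le, rfl⟩
  have hi'le := hw.suffix_le _ _ hsuf'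
  have ht : PTest γ β n x (w i') :=
    (hset i' (hi'le.trans hle) _ (hsuf'.trans hsuf)).2 (by rw [hi']; exact hk)
  have hge : kappa γ β w n x ≤ i' := Nat.sInf_le (by
    obtain ⟨h4, h5⟩ := suffix_initialWord_succ_iff.1 (hsuf'.trans hsuf)
    exact ⟨h4, h5, ht⟩)
  have : i' = kappa γ β w n x := le_antisymm hi'le hge
  rw [rho, ← this, hlen] at hlt
  exact lt_irrefl _ hlt

open scoped Classical in
/-- Lower density of the estimation times on a typical path. -/
lemma le_liminf_proportion {P : ℕ → ℝ} {j₀ J : ℕ} {c : ℝ} {E : Set ℕ} {θ : ℕ → ℕ}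
    (hE : ∀ᶠ n in atTop, θ n ∈ Set.Icc j₀ J ∧ (MemoryAt M w (θ n) n x → n ∈ E))
    (hfreq : Tendsto
      (fun n : ℕ => (((Finset.range n).filter fun m => MemoryAt M w j₀ m x).card : ℝ) / n) atTop
      (𝓝 (P j₀))) (hc : c < P j₀) :
    c ≤ liminf (fun n : ℕ => proportion E n) atTop := by
  obtain ⟨b, hb1, hb2⟩ := exists_between hc
  obtain ⟨L, hL⟩ := eventually_atTop.1 hE
  have hsmall : Tendsto (fun n : ℕ => (L : ℝ) / n) atTop (𝓝 0) :=
    tendsto_const_div_atTop_nhds_zero_nat _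
  have hev : ∀ᶠ n : ℕ in atTop, c ≤ proportion E n := by
    filter_upwards [hfreq.eventually (lt_mem_nhds hb2),
      hsmall.eventually (gt_mem_nhds (sub_pos.2 hb1))] with n h1 h2
    have hsub : (Finset.range n).filter (fun m => MemoryAt M w j₀ m x) ⊆
        (Finset.range n).filter (fun m => m ∈ E) ∪ Finset.range L := by
      intro m hm
      rw [Finset.mem_filter] at hm
      rw [Finset.mem_union, Finset.mem_filter, Finset.mem_range (n := L)]
      by_cases hmL : m < L
      · exact Or.inr hmL
      · obtain ⟨h3, h4⟩ := hL m (not_lt.1 hmL)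
        exact Or.inl ⟨hm.1, h4 (hm.2.mono h3.1)⟩
    have hcard : (((Finset.range n).filter fun m => MemoryAt M w j₀ m x).card : ℝ) ≤
        ((Finset.range n).filter fun m => m ∈ E).card + L := by
      have := (Finset.card_le_card hsub).trans (Finset.card_union_le _ _)
      rw [Finset.card_range] at this
      exact_mod_cast this
    have := div_le_div_of_nonneg_right hcard (Nat.cast_nonneg (α := ℝ) n)
    rw [add_div] at this
    rw [proportion]
    linarith
  -- The real `liminf` is meaningful only for a suitably bounded sequence; proportions are at most
  -- 1.
  refine le_liminf_of_le (IsBoundedUnder.isCoboundedUnder_ge ⟨1, ?_⟩) hev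
  rw [eventually_map]
  refine Eventually.of_forall fun n => div_le_one_of_le₀ ?_ (Nat.cast_nonneg _)
  have := Finset.card_filter_le (Finset.range n) fun m => m ∈ E
  rw [Finset.card_range] at this
  exact_mod_cast this

end Estimator

/-! ### The estimator depends only on the observed letters -/

section Observed

variable {A Ω : Type*} {γ β ε : ℝ} {w : ℕ → List A} {n : ℕ} {x y : ℤ → A}

lemma occurrences_congr (h : initialWord x (n + 1) = initialWord y (n + 1)) (u : List A) :
    occurrences n x u = occurrences n y u := by
  ext j
  rw [mem_occurrences, mem_occurrences]
  refine and_congr_right fun hj => ?_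
  rw [initialWord_eq_of_le (by omega) h]

lemma visits_congr (h : initialWord x (n + 1) = initialWord y (n + 1)) (v : List A) :
    visits n x v = visits n y v := by
  ext j
  rw [mem_visits, mem_visits]
  refine and_congr_right fun hj => ?_
  rw [initialWord_eq_of_le (by omega) h]

lemma ptest_congr (h : initialWord x (n + 1) = initialWord y (n + 1)) (u : List A) :
    PTest γ β n x u ↔ PTest γ β n y u := by
  have hp : ∀ a v, empProb n (shift n x) a v = empProb n (shift n y) a v := fun a v => by
    rw [empProb_shift, empProb_shift, occurrences_congr h, visits_congr h]
  have hf : ∀ (z : List A) (a : A), IsFrequent γ n (shift n x) (z ++ u ++ [a]) ↔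
      IsFrequent γ n (shift n y) (z ++ u ++ [a]) := fun z a => by
    rw [isFrequent_shift (by simp), isFrequent_shift (by simp), occurrences_congr h]
  simp only [PTest, NTest, empDelta, hp, hf]

lemma covered_congr (h : initialWord x (n + 1) = initialWord y (n + 1)) (j : ℕ) :
    covered γ β w n x j = covered γ β w n y j := by
  ext m
  rw [mem_covered, mem_covered]
  refine and_congr_right fun hm => exists_congr fun i => ?_
  rw [ptest_congr h, initialWord_eq_of_le (by omega) h]

lemma mem_estTimes_congr (h : initialWord x (n + 1) = initialWord y (n + 1)) :
    n ∈ estTimes γ β ε w x ↔ n ∈ estTimes γ β ε w y := by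
  simp only [estTimes, theta, Set.mem_ofPred_eq, covered_congr h]

lemma rho_congr (h : initialWord x (n + 1) = initialWord y (n + 1)) :
    rho γ β w n x = rho γ β w n y := by
  have : ∀ i, ((w i).length ≤ n + 1 ∧ block x n (w i).length = w i ∧ PTest γ β n x (w i)) ↔
      ((w i).length ≤ n + 1 ∧ block y n (w i).length = w i ∧ PTest γ β n y (w i)) := fun i => by
    rw [← and_assoc, ← and_assoc, ← suffix_initialWord_succ_iff, ← suffix_initialWord_succ_iff, h,
      ptest_congr h]
  simp only [rho, kappa, this]

variable [MeasurableSpace A] [Countable A] [DiscreteMeasurableSpace A]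

/-- The space of (n+1)-tuples of letters is countable and discrete, so dependence on x_0^n alone is
already measurability. -/
lemma measurableSet_observed_of_congr {X : ℤ → Ω → A} {P : (ℤ → A) → Prop}
    (hP : ∀ x y, initialWord x (n + 1) = initialWord y (n + 1) → (P x ↔ P y)) :
    MeasurableSet[observed X n] {ω | P (path X ω)} := by
  refine ⟨{f | ∃ ω, P (path X ω) ∧ (fun i : Fin (n + 1) => X ((i : ℕ) : ℤ) ω) = f},
    MeasurableSet.of_discrete, ?_⟩
  ext ω
  constructor
  · rintro ⟨ω', hω', he⟩
    refine (hP (path X ω') (path X ω) ?_).1 hω'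
    have : ∀ j ≤ n + 1, initialWord (path X ω') j = initialWord (path X ω) j := by
      intro j hj
      induction j with
      | zero => simp [initialWord]
      | succ j ih =>
        exact initialWord_eq_succ_iff.2 ⟨ih (by omega), congrFun he ⟨j, by omega⟩⟩
    exact this _ le_rfl
  · exact fun h => ⟨ω, h, rfl⟩

end Observed

/-! ### The law of the sample path -/

section PathLaw

variable {A Ω : Type*} [MeasurableSpace A] [MeasurableSpace Ω] {μ : Measure Ω} {X : ℤ → Ω → A}

lemma measurable_path (hX : ∀ n, Measurable (X n)) : Measurable (path X) :=
  measurable_pi_lambda _ hX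

variable [Countable A] [DiscreteMeasurableSpace A]

lemma wordProb_eq_lawProb (hX : ∀ n, Measurable (X n)) (v : List A) :
    wordProb μ X v = lawProb (μ.map (path X)) v := by
  rw [lawProb, map_measureReal_apply (measurable_path hX) (measurableSet_cylinder 0 v)]
  rfl

/-- The conditional probability refers to words ending at time 1, `transProb` to words ending at
time 0; stationarity identifies them. -/
lemma nextProb_eq_transProb [IsProbabilityMeasure μ] (hX : ∀ n, Measurable (X n))
    (hT : MeasurePreserving (shift 1) (μ.map (path X)) (μ.map (path X))) (v : List A) (a : A) :
    nextProb μ X a v = transProb (μ.map (path X)) v a := by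
  have hm : MeasurableSet (wordEvent X v) := measurable_path hX (measurableSet_cylinder 0 v)
  have hi : wordEvent X v ∩ {ω | X 1 ω = a} = path X ⁻¹' cylinder 1 (v ++ [a]) := by
    rw [cylinder_append_singleton]
    rfl
  rw [nextProb, measureReal_def, ProbabilityTheory.cond_apply hm, ENNReal.toReal_mul,
    ENNReal.toReal_inv, ← measureReal_def, ← measureReal_def, hi, transProb, ← measureReal_cylinder hT 1,
    map_measureReal_apply (measurable_path hX) (measurableSet_cylinder 1 _),
    ← wordProb_eq_lawProb hX, wordProb, inv_mul_eq_div]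

lemma pastIrrelevant_iff [IsProbabilityMeasure μ] (hX : ∀ n, Measurable (X n))
    (hT : MeasurePreserving (shift 1) (μ.map (path X)) (μ.map (path X))) (v : List A) :
    PastIrrelevant μ X v ↔ IsMemoryWord (μ.map (path X)) v := by
  simp only [PastIrrelevant, IsMemoryWord, wordProb_eq_lawProb hX, nextProb_eq_transProb hX hT]

lemma memoryLength_eq_of_isLeast [IsProbabilityMeasure μ] (hX : ∀ n, Measurable (X n))
    (hT : MeasurePreserving (shift 1) (μ.map (path X)) (μ.map (path X))) {x : ℤ → A} {n : ℤ}
    {r : ℕ} (h : IsMemoryWord (μ.map (path X)) (block x n r))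
    (h' : ∀ k, IsMemoryWord (μ.map (path X)) (block x n k) → r ≤ k) :
    (r : ℕ∞) = memoryLength μ X x n := by
  simp only [memoryLength, pastIrrelevant_iff hX hT]
  refine le_antisymm (le_sInf ?_) (sInf_le ⟨r, h, rfl⟩)
  rintro _ ⟨k, hk, rfl⟩
  exact Nat.cast_le.2 (h' k hk)

lemma ae_exists_isMemoryWord [IsProbabilityMeasure μ] (hX : ∀ n, Measurable (X n))
    (hT : MeasurePreserving (shift 1) (μ.map (path X)) (μ.map (path X)))
    (hfm : IsFinitarilyMarkovian μ X) :
    ∀ᵐ x ∂(μ.map (path X)), ∃ k : ℕ, IsMemoryWord (μ.map (path X)) (block x 0 k) := by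
  have hm : MeasurableSet {x : ℤ → A | ∃ k : ℕ, IsMemoryWord (μ.map (path X)) (block x 0 k)} := by
    rw [Set.ofPred_exists]
    exact MeasurableSet.iUnion fun k => measurableSet_block 0 k _
  refine (ae_map_iff (measurable_path hX).aemeasurable hm).2 ?_
  filter_upwards [hfm] with ω hω
  by_contra hne
  refine hω ?_
  simp only [memoryLength, pastIrrelevant_iff hX hT]
  rw [not_exists] at hne
  have : {k : ℕ | IsMemoryWord (μ.map (path X)) (block (path X ω) 0 k)} = ∅ :=
    Set.eq_empty_iff_forall_notMem.2 hne
  -- If no suffix of the past were a memory word, the infimum defining the memory length would be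
  -- over the empty set, hence infinite.
  rw [this, Set.image_empty, sInf_empty]

/-- The paths on which one of the memory words among `w(0), …, w(j)` ends at time `0`. -/
def memoryEvent (ν : Measure (ℤ → A)) (w : ℕ → List A) (j : ℕ) : Set (ℤ → A) :=
  {x | ∃ i ≤ j, IsMemoryWord ν (w i) ∧ x ∈ cylinder 0 (w i)}

lemma measurableSet_memoryEvent (ν : Measure (ℤ → A)) (w : ℕ → List A) (j : ℕ) :
    MeasurableSet (memoryEvent ν w j) := by
  have : memoryEvent ν w j = ⋃ i, ⋃ _ : i ≤ j ∧ IsMemoryWord ν (w i), cylinder 0 (w i) := by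
    ext x
    simp only [memoryEvent, Set.mem_ofPred_eq, Set.mem_iUnion, exists_prop, and_assoc]
  rw [this]
  exact MeasurableSet.iUnion fun i => MeasurableSet.iUnion fun _ => measurableSet_cylinder 0 _

variable {ν : Measure (ℤ → A)} [IsProbabilityMeasure ν]

lemma tendsto_measureReal_memoryEvent {w : ℕ → List A} (hw : IsWordList w)
    (hν : ∀ᵐ x ∂ν, ∃ k : ℕ, IsMemoryWord ν (block x 0 k)) :
    Tendsto (fun j => ν.real (memoryEvent ν w j)) atTop (𝓝 1) := by
  have hmono : Monotone (memoryEvent ν w) := fun j k hjk x ⟨i, hi, h⟩ => ⟨i, hi.trans hjk, h⟩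
  have huniv : ν (⋃ j, memoryEvent ν w j) = 1 := by
    rw [← mem_ae_iff_prob_eq_one (MeasurableSet.iUnion fun j => measurableSet_memoryEvent ν w j)]
    filter_upwards [hν] with x ⟨k, hk⟩
    obtain ⟨i, hi⟩ := hw.bijective.surjective (block x 0 k)
    refine Set.mem_iUnion.2 ⟨i, i, le_rfl, by rwa [hi], ?_⟩
    rw [cylinder, Set.mem_ofPred_eq, hi, length_block]
  have h := tendsto_measure_iUnion_atTop (μ := ν) hmono
  rw [huniv] at h
  exact (ENNReal.tendsto_toReal ENNReal.one_ne_top).comp h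

open scoped Classical in
lemma ae_tendsto_memoryAt (hT : Ergodic (shift 1) ν) (w : ℕ → List A) :
    ∀ᵐ x ∂ν, ∀ j, Tendsto (fun n : ℕ =>
      (((Finset.range n).filter fun m => MemoryAt (IsMemoryWord ν) w j m x).card : ℝ) / n) atTop
      (𝓝 (ν.real (memoryEvent ν w j))) := by
  refine ae_all_iff.2 fun j => ?_
  filter_upwards [ae_tendsto_frequency hT (measurableSet_memoryEvent ν w j)] with x hx
  -- The sum of the lengths is a crude bound for each of them, so from this time on all the words
  -- fit into the observed segment.
  refine hx _ (∑ i ∈ Finset.range (j + 1), (w i).length) fun m hm => ?_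
  refine exists_congr fun i => and_congr_right fun hi => and_congr_right fun _ => ?_
  rw [suffix_initialWord_succ_iff, cylinder, Set.mem_ofPred_eq, block_shift, zero_add]
  have : (w i).length ≤ ∑ i ∈ Finset.range (j + 1), (w i).length :=
    Finset.single_le_sum (f := fun i => (w i).length) (fun _ _ => Nat.zero_le _)
      (Finset.mem_range.2 (Nat.lt_succ_of_le hi))
  exact ⟨fun h => h.2, fun h => ⟨by omega, h⟩⟩

/-- The almost sure properties of the estimator, for the law of the path. -/
theorem ae_estimator (hT : Ergodic (shift 1) ν)
    (hν : ∀ᵐ x ∂ν, ∃ k : ℕ, IsMemoryWord ν (block x 0 k)) {γ β ε : ℝ} (hγ0 : 0 < γ)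
    (hγ1 : γ < 1) (hβ0 : 0 < β) (hβ1 : β < (1 - γ) / 2) (hε : 0 < ε) {w : ℕ → List A}
    (hw : IsWordList w) :
    ∀ᵐ x ∂ν, (∀ᶠ n : ℕ in atTop, n ∈ estTimes γ β ε w x →
        IsMemoryWord ν (block x n (rho γ β w n x)) ∧
        (∀ k, IsMemoryWord ν (block x n k) → rho γ β w n x ≤ k) ∧
        (n : ℝ) ^ (1 - γ) ≤ ((occurrences n x (block x n (rho γ β w n x))).card : ℝ)) ∧
      1 - ε ≤ liminf (fun n : ℕ => proportion (estTimes γ β ε w x) n) atTop := by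
  classical
  -- The inequality at J is strict so that it survives passing to empirical frequencies; for j₀ the
  -- weak one is needed, so that every j < j₀ is strictly below 1 - ε/2.
  obtain ⟨J, hJ⟩ := ((tendsto_measureReal_memoryEvent hw hν).eventually
    (lt_mem_nhds (by linarith : 1 - ε / 2 < 1))).exists
  have hex : ∃ j, 1 - ε / 2 ≤ ν.real (memoryEvent ν w j) := ⟨J, hJ.le⟩
  set j₀ := Nat.find hex with hj₀
  have hj₀J : j₀ ≤ J := Nat.find_min' hex hJ.le
  filter_upwards [ae_eventually_ptest_iff hT hγ0 hγ1 hβ0 hβ1, ae_tendsto_memoryAt hT w,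
    ae_not_suffix_of_lawProb_eq_zero hT.toMeasurePreserving, ae_tendsto_card_occurrences hT]
    with x hset hfreq hnull hocc
  have hset' : ∀ᶠ n : ℕ in atTop, ∀ i ∈ Finset.range (J + 1), ∀ k : ℕ,
      w i <:+ initialWord x k → (PTest γ β n x (w i) ↔ IsMemoryWord ν (w i)) :=
    (Finset.eventually_all _).2 fun i _ => hset (w i)
  have hocc' : ∀ᶠ n : ℕ in atTop, ∀ i ∈ Finset.range (J + 1), 0 < lawProb ν (w i) →
      (n : ℝ) ^ (1 - γ) < ((occurrences n x (w i)).card : ℝ) :=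
    (Finset.eventually_all _).2 fun i _ => by
      by_cases hp : 0 < lawProb ν (w i)
      · filter_upwards [eventually_rpow_lt_of_tendsto hp hγ0 (hocc (w i))] with n hn _ using hn
      · exact Eventually.of_forall fun n h => absurd h hp
  have hθ := eventually_theta_mem_Icc (ε := ε) hset hfreq
    (fun j hj => not_le.1 (Nat.find_min hex hj)) hJ hj₀J
  constructor
  · filter_upwards [hset', hocc', hθ] with n h1 h2 h3 hn
    obtain ⟨hκ, hb, hM, hsuf, hmin⟩ := kappa_spec hw h3.2
      (fun i hi => h1 i (Finset.mem_range.2 (by omega))) hn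
    refine ⟨hM, hmin, ?_⟩
    rw [hb]
    refine (h2 _ (Finset.mem_range.2 (by omega)) ?_).le
    -- The selected word ends at time n on the path, so its probability is positive.
    exact (lawProb_nonneg _).lt_of_ne fun h0 => hnull _ h0.symm _ hsuf
  · refine le_liminf_proportion (P := fun j => ν.real (memoryEvent ν w j))
      (θ := fun n => theta γ β ε w n x) (j₀ := j₀) (J := J) ?_ (hfreq j₀)
      (lt_of_lt_of_le (by linarith) (Nat.find_spec hex))
    filter_upwards [hset', hθ] with n h1 h3
    refine ⟨h3, fun hm => ?_⟩
    exact (mem_covered_iff_memoryAt h3.2 fun i hi => h1 i (Finset.mem_range.2 (by omega))).2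
      ⟨le_rfl, hm⟩

end PathLaw

end MemoryEstimation

end

theorem mainTheorem2 {A Ω : Type*} [Countable A] [MeasurableSpace A] [DiscreteMeasurableSpace A]
    [MeasurableSpace Ω] (μ : MeasureTheory.Measure Ω) [MeasureTheory.IsProbabilityMeasure μ]
    (X : ℤ → Ω → A) (hX : ∀ n, Measurable (X n))
    (hstat : MemoryEstimation.IsStationaryErgodic μ X)
    (hfm : MemoryEstimation.IsFinitarilyMarkovian μ X)
    (γ β : ℝ) (hγ0 : 0 < γ) (hγ1 : γ < 1) (hβ0 : 0 < β) (hβ1 : β < (1 - γ) / 2)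
    (w : ℕ → List A) (hw : MemoryEstimation.IsWordList w)
    (ε : ℝ) (hε : 0 < ε) :
    -- membership in `𝒩` and the estimator at time `n` are determined by `X_0, …, X_n`
    (∀ n : ℕ, MeasurableSet[MemoryEstimation.observed X n]
        {ω | n ∈ MemoryEstimation.estTimes γ β ε w (MemoryEstimation.path X ω)}) ∧
    (∀ n : ℕ, Measurable[MemoryEstimation.observed X n]
        fun ω => MemoryEstimation.rho γ β w n (MemoryEstimation.path X ω)) ∧
    -- consistency along `𝒩`
    (∀ᵐ ω ∂μ, ∀ᶠ n : ℕ in Filter.atTop,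
      n ∈ MemoryEstimation.estTimes γ β ε w (MemoryEstimation.path X ω) →
        (MemoryEstimation.rho γ β w n (MemoryEstimation.path X ω) : ℕ∞) =
          MemoryEstimation.memoryLength μ X (MemoryEstimation.path X ω) n) ∧
    -- lower density of `𝒩`
    (∀ᵐ ω ∂μ, 1 - ε ≤ Filter.liminf
      (fun n : ℕ => MemoryEstimation.proportion
        (MemoryEstimation.estTimes γ β ε w (MemoryEstimation.path X ω)) n) Filter.atTop) ∧
    -- number of occurrences of the estimated memory word in `X_0^n`
    (∀ᵐ ω ∂μ, ∀ᶠ n : ℕ in Filter.atTop,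
      n ∈ MemoryEstimation.estTimes γ β ε w (MemoryEstimation.path X ω) →
        (n : ℝ) ^ (1 - γ) ≤
          ((MemoryEstimation.occurrences n (MemoryEstimation.path X ω)
            (MemoryEstimation.block (MemoryEstimation.path X ω) n
              (MemoryEstimation.rho γ β w n (MemoryEstimation.path X ω)))).card : ℝ)) := by
  have hp := MemoryEstimation.measurable_path hX
  have hprob : MeasureTheory.IsProbabilityMeasure (μ.map (MemoryEstimation.path X)) :=
    MeasureTheory.Measure.isProbabilityMeasure_map hp.aemeasurable
  have hT : Ergodic (MemoryEstimation.shift 1) (μ.map (MemoryEstimation.path X)) := hstat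
  have h := MeasureTheory.ae_of_ae_map hp.aemeasurable (MemoryEstimation.ae_estimator hT
    (MemoryEstimation.ae_exists_isMemoryWord hX hT.toMeasurePreserving hfm) hγ0 hγ1 hβ0 hβ1 hε hw)
  refine ⟨fun n => MemoryEstimation.measurableSet_observed_of_congr fun x y hxy =>
    MemoryEstimation.mem_estTimes_congr hxy, fun n s _ => ?_, ?_, ?_, ?_⟩
  · exact MemoryEstimation.measurableSet_observed_of_congr
      (P := fun x => MemoryEstimation.rho γ β w n x ∈ s) fun x y hxy => by
        rw [MemoryEstimation.rho_congr hxy]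
  · filter_upwards [h] with ω hω
    filter_upwards [hω.1] with n hn hmem
    exact MemoryEstimation.memoryLength_eq_of_isLeast hX hT.toMeasurePreserving (hn hmem).1
      (hn hmem).2.1
  · filter_upwards [h] with ω hω using hω.2
  · filter_upwards [h] with ω hω
    filter_upwards [hω.1] with n hn hmem using (hn hmem).2.2
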